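/- Let $n\ge 7$ and let $X^n=\operatorname{conv}(\pm e_1,\dots,\pm e_n)\subset\mathbb R^n$ be the regular cross-polytope, whose inradius is $r_n=1/\sqrt n$. A packing of congruent copies of $X^n$ is a family of images of $X^n$ under isometries of $\mathbb R^n$ with pairwise disjoint interiors; its density is $\limsup_{R\to\infty}$ of the proportion of the ball of radius $R$ about the origin covered by the members of the family, and the packing density $\delta(X^n)$ is the supremum of the densities of all such packings. Put $f_0(r)=1-r^2/2$ for $0\le r\le\sqrt2$ and $f_0(r)=0$ for $r>\sqrt2$; put $f^*(r)=f_0(r)$ for $r\ge1$ and $f^*(r)=1-f_0(2-r)$ for $0\le r<1$. For $0<\varrho\le r_n$ let $X^n_{-\varrho}=\{x\in X^n: x+\varrho B^n\subseteq X^n\}$, where $B^n$ is the closed unit ball, and $$G(\varrho)=\int_{\mathbb R^n} f^*\!\left(\frac{d(x,X^n_{-\varrho})}{\varrho}\right)dx,$$ where $d$ denotes Euclidean distance. Then $$\delta(X^n)<1 .$$ More precisely, $\delta(X^n)\le \operatorname{vol}(X^n)/G(\varrho)$ for every $0<\varrho\le r_n$, and $\operatorname{vol}(X^n)/G(\varrho)<1$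 for all sufficiently small $\varrho>0$. -/

import Mathlib

open Set Filter Topology MeasureTheory
open scoped ENNReal

/-- `𝒦` is a packing of congruent copies of `K` in `ℝⁿ`: every member of the family `𝒦` is the
image of `K` under an isometry of `ℝⁿ`, and the interiors of distinct members are disjoint. -/
def IsCongruentPacking {n : ℕ} (K : Set (EuclideanSpace ℝ (Fin n)))
    (𝒦 : Set (Set (EuclideanSpace ℝ (Fin n)))) : Prop :=
  (∀ L ∈ 𝒦, ∃ φ : EuclideanSpace ℝ (Fin n) ≃ᵢ EuclideanSpace ℝ (Fin n), L = φ '' K) ∧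
    𝒦.PairwiseDisjoint interior

/-- The (upper) density of a family of sets: the upper limit, as `R → ∞`, of the proportion of the
ball of radius `R` about the origin that is covered by the members of the family. -/
noncomputable def upperDensity {n : ℕ} (𝒦 : Set (Set (EuclideanSpace ℝ (Fin n)))) : ℝ≥0∞ :=
  limsup (fun R : ℝ =>
    volume ((⋃₀ 𝒦) ∩ Metric.closedBall (0 : EuclideanSpace ℝ (Fin n)) R) /
      volume (Metric.closedBall (0 : EuclideanSpace ℝ (Fin n)) R)) atTop

/-- The packing density `δ(K)`: the supremum of the densities of all packings of congruent copies
of `K`. -/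
noncomputable def packingDensity {n : ℕ} (K : Set (EuclideanSpace ℝ (Fin n))) : ℝ≥0∞ :=
  ⨆ (𝒦 : Set (Set (EuclideanSpace ℝ (Fin n)))) (_ : IsCongruentPacking K 𝒦), upperDensity 𝒦

/-- The regular cross-polytope `Xⁿ = conv(±e₁, …, ±eₙ)`. -/
def crossPolytope (n : ℕ) : Set (EuclideanSpace ℝ (Fin n)) :=
  convexHull ℝ
    (range (fun i : Fin n => EuclideanSpace.single i (1 : ℝ)) ∪
      range (fun i : Fin n => -EuclideanSpace.single i (1 : ℝ)))

/-- The inner parallel domain `{x ∈ K : x + ϱ Bⁿ ⊆ K}`. -/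
def innerParallel {n : ℕ} (K : Set (EuclideanSpace ℝ (Fin n))) (ϱ : ℝ) :
    Set (EuclideanSpace ℝ (Fin n)) :=
  {x ∈ K | Metric.closedBall x ϱ ⊆ K}

/-- Blichfeldt's gauge `f₀` on `[0, ∞)`. -/
noncomputable def gaugeZero (r : ℝ) : ℝ :=
  if r ≤ √2 then 1 - r ^ 2 / 2 else 0

/-- The improved gauge `f*` on `[0, ∞)`. -/
noncomputable def gaugeStar (r : ℝ) : ℝ :=
  if 1 ≤ r then gaugeZero r else 1 - gaugeZero (2 - r)

/-- `G(ϱ) = ∫ f(d(x, K_{-ϱ}) / ϱ) dx` over `ℝⁿ`, for a gauge `f ≥ 0`. -/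
noncomputable def gaugeIntegral {n : ℕ} (f : ℝ → ℝ) (K : Set (EuclideanSpace ℝ (Fin n)))
    (ϱ : ℝ) : ℝ≥0∞ :=
  ∫⁻ x, ENNReal.ofReal (f (Metric.infDist x (innerParallel K ϱ) / ϱ))

/-!
Blichfeldt's method. If finitely many points have mutual distances at least `2`, then the values of
the gauge `f₀` at their distances from any fixed point sum to at most `1`. This comes from summing
the squares of the mutual distances (`sum_gaugeZero_le_one`). If one of the points is closer than
`1`, it excludes the others from a neighbourhood; giving it a suitable weight in the barycentre shows
that the other points contribute at most `f₀ (2 - r)`, where `r` is its distance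
(`sum_gaugeZero_le_of_norm_lt_one`). Hence the inequality holds for `f*` too
(`sum_gaugeStar_le_one`).

In a packing of copies of `K`, points of the inner parallel domains of different copies have distance
at least `2ϱ`. So the functions `x ↦ f*(d(x, L_{-ϱ}) / ϱ)`, for `L` in the packing, sum to at most `1`
everywhere. Each has integral `G(ϱ)`, and integrating over a ball slightly larger than that of
radius `R` gives `δ(K) ≤ vol K / G(ϱ)` (`packingDensity_le_volume_div_gaugeIntegral`).

It remains to see that `G(ϱ) > vol Xⁿ` for small `ϱ`. The inner parallel domain of `Xⁿ` contains the
`ℓ¹`-ball of radius `l = 1 - √n ϱ`. Since `f*` is decreasing, `G(ϱ)` is at least the sum of three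
integrals over disjoint sets: this ball, the points over its facets, and the points over its ridges.
The last two are computed from the distribution of the excess `τ`, the common amount by which the
large coordinates are lowered when projecting to the ball (`lintegral_facetRegion`). As
`∫ f* = 1`, writing `x = √n ϱ` one obtains, up to the factor `vol Xⁿ`,
`(1 - x)ⁿ + n x (1 - x)ⁿ⁻¹ + κ n (n - 1) x² (1 - x)ⁿ⁻²`. With `κ = 1 / 2` these are three terms of the
binomial expansion of `1`, so the sum exceeds `1` for small `x` as soon as `κ > 1 / 2`
(`eventually_one_lt_of_half_lt`). Bounding the angle at a ridge from below gives
`κ = (1 - 1 / (3 (n - 1))) ∫ r f*(r) dr`, which is larger than `1 / 2` when `n ≥ 7`, because the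
moment is `29/12 - 4√2/3 > 9/17`.
-/

/-! ### The gauges -/

theorem one_le_sqrt_two : (1 : ℝ) ≤ √2 := Real.one_le_sqrt.2 (by norm_num)

theorem gaugeZero_nonneg {r : ℝ} (hr : 0 ≤ r) : 0 ≤ gaugeZero r := by
  unfold gaugeZero
  split_ifs with h
  · nlinarith [Real.sq_sqrt (zero_le_two (α := ℝ)), Real.sqrt_nonneg 2]
  · exact le_rfl

theorem gaugeZero_le_one (r : ℝ) : gaugeZero r ≤ 1 := by
  unfold gaugeZero
  split_ifs <;> nlinarith [sq_nonneg r]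

theorem gaugeZero_antitone {r s : ℝ} (hr : 0 ≤ r) (hrs : r ≤ s) : gaugeZero s ≤ gaugeZero r := by
  by_cases h : s ≤ √2
  · rw [gaugeZero, gaugeZero, if_pos h, if_pos (hrs.trans h)]
    nlinarith
  · rw [gaugeZero, if_neg h]
    exact gaugeZero_nonneg hr

theorem gaugeStar_of_one_le {r : ℝ} (hr : 1 ≤ r) : gaugeStar r = gaugeZero r := if_pos hr

theorem gaugeStar_of_lt_one {r : ℝ} (hr : r < 1) : gaugeStar r = 1 - gaugeZero (2 - r) :=
  if_neg hr.not_ge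

theorem gaugeStar_of_sqrt_two_lt {r : ℝ} (hr : √2 < r) : gaugeStar r = 0 := by
  rw [gaugeStar_of_one_le (one_le_sqrt_two.trans hr.le), gaugeZero, if_neg hr.not_ge]

theorem gaugeZero_one : gaugeZero 1 = 1 / 2 := by
  rw [gaugeZero, if_pos one_le_sqrt_two]; norm_num

theorem gaugeStar_nonneg {r : ℝ} (hr : 0 ≤ r) : 0 ≤ gaugeStar r := by
  rcases le_or_gt 1 r with h | h
  · rw [gaugeStar_of_one_le h]; exact gaugeZero_nonneg hr
  · rw [gaugeStar_of_lt_one h]; linarith [gaugeZero_le_one (2 - r)]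

theorem gaugeStar_antitoneOn : AntitoneOn gaugeStar (Ici 0) := by
  intro r hr s _ hrs
  have hr : 0 ≤ r := hr
  rcases le_or_gt 1 r with h | h
  · rw [gaugeStar_of_one_le h, gaugeStar_of_one_le (h.trans hrs)]
    exact gaugeZero_antitone hr hrs
  · rw [gaugeStar_of_lt_one h]
    have h1 := gaugeZero_antitone zero_le_one (show (1 : ℝ) ≤ 2 - r by linarith)
    rcases le_or_gt 1 s with h' | h'
    · rw [gaugeStar_of_one_le h']
      have h2 := gaugeZero_antitone zero_le_one h'
      rw [gaugeZero_one] at h1 h2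
      linarith
    · rw [gaugeStar_of_lt_one h']
      linarith [gaugeZero_antitone (show (0 : ℝ) ≤ 2 - s by linarith)
        (show 2 - s ≤ 2 - r by linarith)]

theorem measurable_gaugeZero : Measurable gaugeZero :=
  Measurable.ite measurableSet_Iic (by fun_prop) measurable_const

theorem measurable_gaugeStar : Measurable gaugeStar :=
  Measurable.ite measurableSet_Ici measurable_gaugeZero
    (measurable_const.sub (measurable_gaugeZero.comp (by fun_prop)))

/-! ### Blichfeldt's inequality -/

section Blichfeldt

variable {ι E : Type*} [NormedAddCommGroup E] [InnerProductSpace ℝ E]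

theorem sum_sum_norm_sub_sq (s : Finset ι) (v : ι → E) :
    ∑ i ∈ s, ∑ j ∈ s, ‖v i - v j‖ ^ 2 =
      2 * s.card * ∑ i ∈ s, ‖v i‖ ^ 2 - 2 * ‖∑ i ∈ s, v i‖ ^ 2 := by
  have h : ‖∑ i ∈ s, v i‖ ^ 2 = ∑ i ∈ s, ∑ j ∈ s, inner ℝ (v i) (v j) := by
    rw [← real_inner_self_eq_norm_sq, sum_inner]
    exact Finset.sum_congr rfl fun i _ => inner_sum _ _ _
  simp only [norm_sub_sq_real, Finset.sum_add_distrib, Finset.sum_sub_distrib, Finset.sum_const,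
    h, ← Finset.mul_sum, nsmul_eq_mul]
  ring

/-- Points at mutual distance at least `2` have a large total spread about the origin: sum the
squares of all their mutual distances. -/
theorem norm_sum_sq_le_of_separated (s : Finset ι) (v : ι → E)
    (hv : ∀ i ∈ s, ∀ j ∈ s, i ≠ j → 2 ≤ ‖v i - v j‖) :
    2 * (s.card : ℝ) * (s.card - 1) + ‖∑ i ∈ s, v i‖ ^ 2 ≤ s.card * ∑ i ∈ s, ‖v i‖ ^ 2 := by
  classical
  have h : ∑ i ∈ s, ∑ j ∈ s, (if i = j then (0 : ℝ) else 4) ≤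
      ∑ i ∈ s, ∑ j ∈ s, ‖v i - v j‖ ^ 2 := by
    refine Finset.sum_le_sum fun i hi => Finset.sum_le_sum fun j hj => ?_
    split_ifs with hij
    · positivity
    · nlinarith [hv i hi j hj hij]
  have h' : ∑ i ∈ s, ∑ j ∈ s, (if i = j then (0 : ℝ) else 4) =
      4 * (s.card : ℝ) * (s.card - 1) := by
    have : ∀ i ∈ s, ∑ j ∈ s, (if i = j then (0 : ℝ) else 4) = 4 * ((s.card : ℝ) - 1) := by
      intro i hi
      have e : ∀ j ∈ s, (if i = j then (0 : ℝ) else 4) = 4 - if i = j then 4 else 0 := by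
        intro j _; split_ifs <;> norm_num
      rw [Finset.sum_congr rfl e, Finset.sum_sub_distrib, Finset.sum_ite_eq, if_pos hi]
      simp; ring
    rw [Finset.sum_congr rfl this, Finset.sum_const, nsmul_eq_mul]
    ring
  rw [h', sum_sum_norm_sub_sq] at h
  linarith

theorem sum_gaugeZero_eq {ι E : Type*} [NormedAddCommGroup E] (s : Finset ι) (v : ι → E) :
    ∑ i ∈ s, gaugeZero ‖v i‖ =
      ((s.filter fun i => ‖v i‖ ≤ √2).card : ℝ) -
        (∑ i ∈ s.filter (fun i => ‖v i‖ ≤ √2), ‖v i‖ ^ 2) / 2 := by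
  unfold gaugeZero
  rw [← Finset.sum_filter, Finset.sum_sub_distrib, ← Finset.sum_div]
  simp

/-- Blichfeldt's inequality for `f₀`. -/
theorem sum_gaugeZero_le_one (s : Finset ι) (v : ι → E)
    (hv : ∀ i ∈ s, ∀ j ∈ s, i ≠ j → 2 ≤ ‖v i - v j‖) :
    ∑ i ∈ s, gaugeZero ‖v i‖ ≤ 1 := by
  rw [sum_gaugeZero_eq]
  set t := s.filter fun i => ‖v i‖ ≤ √2 with ht
  have hts : t ⊆ s := Finset.filter_subset _ _
  have h := norm_sum_sq_le_of_separated t v fun i hi j hj => hv i (hts hi) j (hts hj)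
  rcases t.eq_empty_or_nonempty with h0 | h0
  · simp [h0]
  · have hk : (0 : ℝ) < t.card := by exact_mod_cast h0.card_pos
    by_contra! hc
    nlinarith [sq_nonneg ‖∑ i ∈ t, v i‖]

/-- If one of the points, `w`, lies at distance less than `1` from the origin, then the `f₀`-sum
over the others is at most the value that a single point antipodal to `w` would give. -/
theorem sum_gaugeZero_le_of_norm_lt_one (s : Finset ι) (v : ι → E) (w : E) (hw : ‖w‖ < 1)
    (hv : ∀ i ∈ s, ∀ j ∈ s, i ≠ j → 2 ≤ ‖v i - v j‖) (hvw : ∀ i ∈ s, 2 ≤ ‖v i - w‖) :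
    ∑ i ∈ s, gaugeZero ‖v i‖ ≤ gaugeZero (2 - ‖w‖) := by
  rw [sum_gaugeZero_eq]
  set t := s.filter fun i => ‖v i‖ ≤ √2 with ht
  have hts : t ⊆ s := Finset.filter_subset _ _
  rcases t.eq_empty_or_nonempty with h0 | ⟨i₀, hi₀⟩
  · simpa [h0] using gaugeZero_nonneg (show (0 : ℝ) ≤ 2 - ‖w‖ by linarith)
  have h := norm_sum_sq_le_of_separated t v fun i hi j hj => hv i (hts hi) j (hts hj)
  have hk : (1 : ℝ) ≤ t.card := by exact_mod_cast Finset.card_pos.2 ⟨i₀, hi₀⟩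
  have hle : 2 - ‖w‖ ≤ √2 := by
    have h1 := norm_sub_le (v i₀) w
    have h2 := hvw i₀ (hts hi₀)
    have h3 := (Finset.mem_filter.1 hi₀).2
    linarith
  have hs : 0 < ‖w‖ := by
    have : √2 < 2 := by rw [Real.sqrt_lt' (by norm_num)]; norm_num
    linarith
  rw [gaugeZero, if_pos hle]
  have hcross : 4 * (t.card : ℝ) ≤
      ∑ i ∈ t, ‖v i‖ ^ 2 - 2 * inner ℝ (∑ i ∈ t, v i) w + t.card * ‖w‖ ^ 2 := by
    have e : ∑ i ∈ t, ‖v i - w‖ ^ 2 =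
        ∑ i ∈ t, ‖v i‖ ^ 2 - 2 * inner ℝ (∑ i ∈ t, v i) w + t.card * ‖w‖ ^ 2 := by
      simp only [norm_sub_sq_real, Finset.sum_add_distrib, Finset.sum_sub_distrib,
        ← Finset.mul_sum, sum_inner, Finset.sum_const, nsmul_eq_mul]
    rw [← e]
    have : ∑ i ∈ t, (4 : ℝ) ≤ ∑ i ∈ t, ‖v i - w‖ ^ 2 :=
      Finset.sum_le_sum fun i hi => by nlinarith [hvw i (hts hi)]
    simpa [mul_comm] using this
  set D := ∑ i ∈ t, ‖v i‖ ^ 2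
  set k := (t.card : ℝ)
  set σ := ‖w‖
  -- `w` gets the weight `l` in a barycentre in which the other points have weight `1`. The optimal
  -- value of `2 σ (k + l)` is `2 √(2 k (k + 1))`; its upper bound `3 k + 1` has the same value at
  -- `k = 1` and suffices for all `k`.
  obtain ⟨l, hl, hl0⟩ : ∃ l : ℝ, 2 * σ * (k + l) = 3 * k + 1 ∧ 0 < l := by
    refine ⟨(3 * k + 1) / (2 * σ) - k, by field_simp; ring, ?_⟩
    rw [sub_pos, lt_div_iff₀ (by positivity)]
    nlinarith
  have hsq : 0 ≤ ‖∑ i ∈ t, v i‖ ^ 2 + 2 * l * inner ℝ (∑ i ∈ t, v i) w + l ^ 2 * σ ^ 2 := by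
    have := sq_nonneg ‖∑ i ∈ t, v i + l • w‖
    rw [norm_add_sq_real, inner_smul_right, norm_smul, Real.norm_of_nonneg hl0.le] at this
    linarith
  set P := inner ℝ (∑ i ∈ t, v i) w
  have hmain : 2 * k * (k - 1) + 4 * l * k ≤ (k + l) * (D + l * σ ^ 2) := by
    nlinarith [mul_le_mul_of_nonneg_left hcross hl0.le]
  have hT : 0 < k + l := by linarith
  by_contra! hc
  -- With `T = k + l` the negated claim reads `T (2 (k - 1) + 4 σ + (k - 1) σ²) < 2 k (k + 1) + T² σ²`.
  -- The left side is at least `T σ (3 k + 1)`, because `(1 - σ) (2 - σ) ≥ 0`, and then the choice of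
  -- `l` leaves `(3 k + 1)² < 8 k (k + 1)`.
  have hD : D < 2 * (k - 1) + (2 - σ) ^ 2 := by linarith
  have h5 : (k + l) * D < (k + l) * (2 * (k - 1) + (2 - σ) ^ 2) := by gcongr
  set T := k + l with hTdef
  have hl' : l = T - k := by linarith
  rw [hl'] at hmain
  have h6 : T * (2 * (k - 1) + 4 * σ + (k - 1) * σ ^ 2) < 2 * k * (k + 1) + T ^ 2 * σ ^ 2 := by
    nlinarith
  have h7 : T * (σ * (3 * k + 1)) ≤ T * (2 * (k - 1) + 4 * σ + (k - 1) * σ ^ 2) := by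
    refine mul_le_mul_of_nonneg_left ?_ hT.le
    nlinarith [mul_nonneg (sub_nonneg.2 hk) (mul_nonneg (sub_nonneg.2 hw.le)
      (show (0 : ℝ) ≤ 2 - σ by linarith))]
  have h8 : T * (σ * (3 * k + 1)) = (3 * k + 1) ^ 2 / 2 := by
    have : T * σ = (3 * k + 1) / 2 := by linarith
    rw [← mul_assoc, this]; ring
  have h9 : T ^ 2 * σ ^ 2 = (3 * k + 1) ^ 2 / 4 := by
    have : T * σ = (3 * k + 1) / 2 := by linarith
    rw [← mul_pow, this]; ring
  nlinarith [sq_nonneg (k - 1)]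

/-- Blichfeldt's inequality for the improved gauge `f*`. At most one of the points is closer than `1`
to the origin, so `f*` and `f₀` differ at no more than one term. -/
theorem sum_gaugeStar_le_one (s : Finset ι) (v : ι → E)
    (hv : ∀ i ∈ s, ∀ j ∈ s, i ≠ j → 2 ≤ ‖v i - v j‖) :
    ∑ i ∈ s, gaugeStar ‖v i‖ ≤ 1 := by
  classical
  by_cases h : ∃ i ∈ s, ‖v i‖ < 1
  · obtain ⟨i, hi, h1⟩ := h
    rw [← Finset.add_sum_erase s _ hi, gaugeStar_of_lt_one h1]
    have e : ∀ j ∈ s.erase i, gaugeStar ‖v j‖ = gaugeZero ‖v j‖ := by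
      intro j hj
      obtain ⟨hji, hj⟩ := Finset.mem_erase.1 hj
      exact gaugeStar_of_one_le (by linarith [norm_sub_le (v j) (v i), hv j hj i hi hji])
    rw [Finset.sum_congr rfl e]
    have := sum_gaugeZero_le_of_norm_lt_one (s.erase i) v (v i) h1
      (fun a ha b hb => hv a (Finset.mem_of_mem_erase ha) b (Finset.mem_of_mem_erase hb))
      (fun a ha => hv a (Finset.mem_of_mem_erase ha) i hi (Finset.ne_of_mem_erase ha))
    linarith
  · push Not at h
    rw [Finset.sum_congr rfl fun i hi => gaugeStar_of_one_le (h i hi)]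
    exact sum_gaugeZero_le_one s v hv

end Blichfeldt

/-! ### The density bound for an arbitrary compact body -/

section DensityBound

variable {n : ℕ} {K L : Set (EuclideanSpace ℝ (Fin n))} {ϱ : ℝ}

theorem innerParallel_image (φ : EuclideanSpace ℝ (Fin n) ≃ᵢ EuclideanSpace ℝ (Fin n))
    (K : Set (EuclideanSpace ℝ (Fin n))) (ϱ : ℝ) :
    innerParallel (φ '' K) ϱ = φ '' innerParallel K ϱ := by
  ext y
  obtain ⟨x, rfl⟩ := φ.surjective y
  simp only [innerParallel, mem_ofPred_eq, φ.injective.mem_set_image, ← φ.image_closedBall,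
    image_subset_image_iff φ.injective]

theorem isClosed_innerParallel (hK : IsClosed K) (ϱ : ℝ) : IsClosed (innerParallel K ϱ) := by
  have : innerParallel K ϱ =
      K ∩ ⋂ v ∈ Metric.closedBall (0 : EuclideanSpace ℝ (Fin n)) ϱ, (fun x => x + v) ⁻¹' K := by
    ext x
    simp only [innerParallel, mem_inter_iff, mem_iInter, mem_preimage, mem_ofPred_eq]
    refine and_congr_right fun _ => ⟨fun h v hv => h (by simpa using hv), fun h y hy => ?_⟩
    simpa using h (y - x) (by simpa [dist_eq_norm] using hy)
  rw [this]
  exact hK.inter (isClosed_biInter fun v _ => hK.preimage (by fun_prop))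

theorem innerParallel_subset (K : Set (EuclideanSpace ℝ (Fin n))) (ϱ : ℝ) :
    innerParallel K ϱ ⊆ K := fun _ hx => hx.1

theorem two_mul_le_dist_of_mem_innerParallel (hϱ : 0 < ϱ)
    (hKL : Disjoint (interior K) (interior L)) {x y : EuclideanSpace ℝ (Fin n)}
    (hx : x ∈ innerParallel K ϱ) (hy : y ∈ innerParallel L ϱ) : 2 * ϱ ≤ dist x y := by
  have h : Disjoint (Metric.ball x ϱ) (Metric.ball y ϱ) :=
    hKL.mono (interior_maximal (Metric.ball_subset_closedBall.trans hx.2) Metric.isOpen_ball)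
      (interior_maximal (Metric.ball_subset_closedBall.trans hy.2) Metric.isOpen_ball)
  rw [disjoint_ball_ball_iff hϱ hϱ] at h
  linarith

theorem measurable_gaugeStar_infDist (s : Set (EuclideanSpace ℝ (Fin n))) (ϱ : ℝ) :
    Measurable fun x => ENNReal.ofReal (gaugeStar (Metric.infDist x s / ϱ)) :=
  (measurable_gaugeStar.comp (measurable_infDist.div_const ϱ)).ennreal_ofReal

theorem measurePreserving_isometryEquiv
    (φ : EuclideanSpace ℝ (Fin n) ≃ᵢ EuclideanSpace ℝ (Fin n)) :
    MeasurePreserving φ volume volume := by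
  have := φ.measurePreserving_euclideanHausdorffMeasure n
  rwa [EuclideanSpace.euclideanHausdorffMeasure_eq_volume] at this

/-- Congruent bodies have the same gauge integral. -/
theorem gaugeIntegral_image (φ : EuclideanSpace ℝ (Fin n) ≃ᵢ EuclideanSpace ℝ (Fin n))
    (K : Set (EuclideanSpace ℝ (Fin n))) (ϱ : ℝ) :
    gaugeIntegral gaugeStar (φ '' K) ϱ = gaugeIntegral gaugeStar K ϱ := by
  unfold gaugeIntegral
  rw [innerParallel_image, ← (measurePreserving_isometryEquiv φ).lintegral_comp
    (measurable_gaugeStar_infDist _ ϱ)]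
  simp_rw [Metric.infDist_image φ.isometry]

theorem volume_isometryEquiv_image
    (φ : EuclideanSpace ℝ (Fin n) ≃ᵢ EuclideanSpace ℝ (Fin n))
    (K : Set (EuclideanSpace ℝ (Fin n))) : volume (φ '' K) = volume K := by
  have := φ.isometry.euclideanHausdorffMeasure_image (d := n) K
  rwa [EuclideanSpace.euclideanHausdorffMeasure_eq_volume] at this

/-- The gauge functions of the members of a packing sum to at most `1` at every point: apply
Blichfeldt's inequality to the points of the inner parallel domains nearest to `x`. -/
theorem IsCongruentPacking.sum_gaugeStar_le_one {𝒦 : Set (Set (EuclideanSpace ℝ (Fin n)))}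
    (h𝒦 : IsCongruentPacking K 𝒦) (hK : IsCompact K) (hϱ : 0 < ϱ)
    (hne : (innerParallel K ϱ).Nonempty) (F : Finset (Set (EuclideanSpace ℝ (Fin n))))
    (hF : ∀ L ∈ F, L ∈ 𝒦) (x : EuclideanSpace ℝ (Fin n)) :
    ∑ L ∈ F, gaugeStar (Metric.infDist x (innerParallel L ϱ) / ϱ) ≤ 1 := by
  have hp : ∀ L ∈ 𝒦, ∃ p ∈ innerParallel L ϱ,
      Metric.infDist x (innerParallel L ϱ) = dist x p := by
    intro L hL
    obtain ⟨φ, rfl⟩ := h𝒦.1 L hL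
    refine IsCompact.exists_infDist_eq_dist ?_ ?_ x
    · rw [innerParallel_image]
      exact (hK.of_isClosed_subset (isClosed_innerParallel hK.isClosed ϱ)
        (innerParallel_subset K ϱ)).image φ.continuous
    · rw [innerParallel_image]
      exact hne.image φ
  choose! p hp hpd using hp
  have e : ∀ L ∈ F, gaugeStar (Metric.infDist x (innerParallel L ϱ) / ϱ) =
      gaugeStar ‖ϱ⁻¹ • (p L - x)‖ := by
    intro L hL
    rw [hpd L (hF L hL), norm_smul, ← dist_eq_norm, dist_comm, norm_inv,
      Real.norm_of_nonneg hϱ.le, div_eq_inv_mul]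
  rw [Finset.sum_congr rfl e]
  refine _root_.sum_gaugeStar_le_one F _ fun L hL M hM hLM => ?_
  have h := two_mul_le_dist_of_mem_innerParallel hϱ (h𝒦.2 (hF L hL) (hF M hM) hLM)
    (hp L (hF L hL)) (hp M (hF M hM))
  rw [← smul_sub, sub_sub_sub_cancel_right, norm_smul, ← dist_eq_norm, norm_inv,
    Real.norm_of_nonneg hϱ.le, ← div_eq_inv_mul, le_div_iff₀ hϱ]
  exact h

/-- The members of a packing that meet a ball of radius `R` cover at most the fraction
`vol K / G(ϱ)` of a ball whose radius is larger by a constant: each member contributes `G(ϱ)` to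
the integral over that ball of a sum of gauge functions which is at most `1`. -/
theorem IsCongruentPacking.volume_inter_closedBall_le
    {𝒦 : Set (Set (EuclideanSpace ℝ (Fin n)))}
    (h𝒦 : IsCongruentPacking K 𝒦) (hK : IsCompact K) (hint : (interior K).Nonempty) (hϱ : 0 < ϱ)
    (hne : (innerParallel K ϱ).Nonempty) {C : ℝ} (hC : 0 ≤ C) (hKC : Metric.diam K + √2 * ϱ ≤ C)
    {R : ℝ} (hR : 0 < R) :
    volume ((⋃₀ 𝒦) ∩ Metric.closedBall 0 R) ≤
      volume K / gaugeIntegral gaugeStar K ϱ *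
        volume (Metric.closedBall (0 : EuclideanSpace ℝ (Fin n)) (R + C)) := by
  set G := gaugeIntegral gaugeStar K ϱ
  set S : Set (Set (EuclideanSpace ℝ (Fin n))) :=
    {L ∈ 𝒦 | (L ∩ Metric.closedBall 0 R).Nonempty} with hS
  have hSc : S.Countable := by
    refine Set.Countable.mono (sep_subset _ _) ?_
    refine h𝒦.2.countable_of_nonempty_interior fun L hL => ?_
    obtain ⟨φ, rfl⟩ := h𝒦.1 L hL
    have := φ.toHomeomorph.image_interior K
    simp only [IsometryEquiv.coe_toHomeomorph] at this
    rw [interior_interior, ← this]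
    exact hint.image φ
  have := hSc.to_subtype
  have hcover : volume ((⋃₀ 𝒦) ∩ Metric.closedBall 0 R) ≤ S.encard * volume K := by
    have hsub : (⋃₀ 𝒦) ∩ Metric.closedBall 0 R ⊆ ⋃ L ∈ S, L := by
      rintro x ⟨⟨L, hL, hxL⟩, hx⟩
      exact mem_biUnion (show L ∈ S from ⟨hL, x, hxL, hx⟩) hxL
    refine (measure_mono hsub).trans ((measure_biUnion_le volume hSc fun L => L).trans ?_)
    rw [← ENNReal.tsum_set_const]
    refine ENNReal.tsum_le_tsum fun L => ?_
    obtain ⟨φ, hφ⟩ := h𝒦.1 L.1 L.2.1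
    rw [hφ, volume_isometryEquiv_image]
  have hcount : S.encard * G ≤
      volume (Metric.closedBall (0 : EuclideanSpace ℝ (Fin n)) (R + C)) := by
    rw [← ENNReal.tsum_set_const]
    have e : ∀ L : S, G =
        ∫⁻ x, ENNReal.ofReal (gaugeStar (Metric.infDist x (innerParallel L.1 ϱ) / ϱ)) := by
      intro L
      obtain ⟨φ, hφ⟩ := h𝒦.1 L.1 L.2.1
      rw [hφ]
      exact (gaugeIntegral_image φ K ϱ).symm
    rw [tsum_congr e, ← lintegral_tsum fun L => (measurable_gaugeStar_infDist _ ϱ).aemeasurable]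
    have hind : ∀ x : EuclideanSpace ℝ (Fin n),
        ∑' L : S, ENNReal.ofReal (gaugeStar (Metric.infDist x (innerParallel L.1 ϱ) / ϱ)) ≤
          (Metric.closedBall 0 (R + C)).indicator 1 x := by
      intro x
      by_cases hx : x ∈ Metric.closedBall 0 (R + C)
      · rw [indicator_of_mem hx, ENNReal.tsum_eq_iSup_sum]
        refine iSup_le fun F => ?_
        rw [← ENNReal.ofReal_sum_of_nonneg fun L _ => gaugeStar_nonneg
          (div_nonneg Metric.infDist_nonneg hϱ.le), Pi.one_apply, ENNReal.ofReal_le_one]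
        have := h𝒦.sum_gaugeStar_le_one hK hϱ hne (F.map (Function.Embedding.subtype _))
          (by simp only [Finset.mem_map]; rintro L ⟨L, -, rfl⟩; exact L.2.1) x
        rwa [Finset.sum_map] at this
      · rw [indicator_of_notMem hx, nonpos_iff_eq_zero, ENNReal.tsum_eq_zero]
        rintro ⟨L, hL, z, hzL, hz⟩
        rw [gaugeStar_of_sqrt_two_lt, ENNReal.ofReal_zero]
        rw [lt_div_iff₀ hϱ]
        by_contra! hc
        apply hx
        obtain ⟨φ, rfl⟩ := h𝒦.1 L hL
        have hne' : (innerParallel (φ '' K) ϱ).Nonempty := by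
          rw [innerParallel_image]; exact hne.image φ
        have hz' : ‖z‖ ≤ R := by simpa using hz
        have hle : ‖x‖ - R - Metric.diam K ≤
            Metric.infDist x (innerParallel (φ '' K) ϱ) := by
          refine (Metric.le_infDist hne').2 fun y hy => ?_
          have h1 : dist y z ≤ Metric.diam K := by
            rw [← φ.isometry.diam_image]
            exact Metric.dist_le_diam_of_mem (hK.image φ.continuous).isBounded hy.1 hzL
          have h2 := dist_triangle4 x y z 0
          rw [dist_zero_right, dist_zero_right] at h2
          linarith
        rw [mem_closedBall_zero_iff]
        linarith
    refine (lintegral_mono hind).trans ?_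
    rw [lintegral_indicator_one Metric.isClosed_closedBall.measurableSet]
  have hb0 : volume (Metric.closedBall (0 : EuclideanSpace ℝ (Fin n)) (R + C)) ≠ 0 :=
    (Metric.measure_closedBall_pos volume _ (by linarith)).ne'
  have hbt : volume (Metric.closedBall (0 : EuclideanSpace ℝ (Fin n)) (R + C)) ≠ ∞ :=
    measure_closedBall_lt_top.ne
  rw [← ENNReal.le_div_iff_mul_le (Or.inr hb0) (Or.inr hbt)] at hcount
  refine hcover.trans ((mul_le_mul_left hcount _).trans_eq ?_)
  simp only [div_eq_mul_inv]
  ring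

theorem tendsto_volume_closedBall_div (n : ℕ) (C : ℝ) (hC : 0 ≤ C) :
    Tendsto (fun R : ℝ => volume (Metric.closedBall (0 : EuclideanSpace ℝ (Fin n)) (R + C)) /
      volume (Metric.closedBall (0 : EuclideanSpace ℝ (Fin n)) R)) atTop (𝓝 1) := by
  have h1 : Tendsto (fun R : ℝ => ENNReal.ofReal ((1 + C / R) ^ n)) atTop (𝓝 1) := by
    have h : Tendsto (fun R : ℝ => (1 + C / R) ^ n) atTop (𝓝 ((1 + 0) ^ n)) :=
      (tendsto_const_nhds.add (tendsto_id.const_div_atTop C)).pow n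
    simpa using ENNReal.tendsto_ofReal h
  refine h1.congr' ?_
  filter_upwards [eventually_gt_atTop 0] with R hR
  have hb0 : volume (Metric.ball (0 : EuclideanSpace ℝ (Fin n)) 1) ≠ 0 :=
    (Metric.measure_ball_pos volume _ one_pos).ne'
  rw [Measure.addHaar_closedBall _ _ (by linarith), Measure.addHaar_closedBall _ _ hR.le,
    ENNReal.mul_div_mul_right _ _ hb0 measure_ball_lt_top.ne,
    ← ENNReal.ofReal_div_of_pos (by positivity), ← div_pow, finrank_euclideanSpace_fin,
    add_div, div_self hR.ne']

/-- Blichfeldt's bound for a compact body `K` with interior points: `δ(K) ≤ vol K / G(ϱ)`. -/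
theorem packingDensity_le_volume_div_gaugeIntegral (hK : IsCompact K)
    (hint : (interior K).Nonempty) (hϱ : 0 < ϱ) (hne : (innerParallel K ϱ).Nonempty) :
    packingDensity K ≤ volume K / gaugeIntegral gaugeStar K ϱ := by
  refine iSup₂_le fun 𝒦 h𝒦 => ?_
  set C := Metric.diam K + √2 * ϱ with hC
  have hC0 : 0 ≤ C := add_nonneg Metric.diam_nonneg (by positivity)
  have hlim := ENNReal.Tendsto.const_mul (a := volume K / gaugeIntegral gaugeStar K ϱ)
    (tendsto_volume_closedBall_div n C hC0) (Or.inl one_ne_zero)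
  rw [mul_one] at hlim
  rw [upperDensity, ← hlim.limsup_eq]
  refine limsup_le_limsup ?_
  filter_upwards [eventually_gt_atTop 0] with R hR
  rw [← mul_div_assoc]
  exact ENNReal.div_le_div_right
    (h𝒦.volume_inter_closedBall_le hK hint hϱ hne hC0 le_rfl hR) _

end DensityBound

/-! ### The cross-polytope as the unit ball of the `ℓ¹`-norm -/

theorem crossPolytope_eq_setOf_sum_abs_le {n : ℕ} (hn : 0 < n) :
    crossPolytope n = {x | ∑ i, |x i| ≤ 1} := by
  apply Subset.antisymm
  · refine convexHull_min ?_ ?_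
    · rintro _ (⟨i, rfl⟩ | ⟨i, rfl⟩) <;>
        simp [apply_ite abs, Finset.sum_ite_eq']
    · intro x hx y hy a b ha hb hab
      have hx : ∑ i, |x i| ≤ 1 := hx
      have hy : ∑ i, |y i| ≤ 1 := hy
      calc ∑ i, |(a • x + b • y) i| ≤ ∑ i, (a * |x i| + b * |y i|) := by
            refine Finset.sum_le_sum fun i _ => (abs_add_le _ _).trans_eq ?_
            simp [abs_mul, abs_of_nonneg ha, abs_of_nonneg hb]
        _ = a * ∑ i, |x i| + b * ∑ i, |y i| := by
            rw [Finset.sum_add_distrib, Finset.mul_sum, Finset.mul_sum]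
        _ ≤ 1 := by nlinarith
  · intro x hx
    have hx : ∑ i, |x i| ≤ 1 := hx
    have hconv : Convex ℝ (crossPolytope n) := convex_convexHull ℝ _
    have hpos (i : Fin n) : EuclideanSpace.single i (1 : ℝ) ∈ crossPolytope n :=
      subset_convexHull ℝ _ (Or.inl ⟨i, rfl⟩)
    have hneg (i : Fin n) : -EuclideanSpace.single i (1 : ℝ) ∈ crossPolytope n :=
      subset_convexHull ℝ _ (Or.inr ⟨i, rfl⟩)
    have h0 : (0 : EuclideanSpace ℝ (Fin n)) ∈ crossPolytope n := by
      have := hconv.midpoint_mem (hpos ⟨0, hn⟩) (hneg ⟨0, hn⟩)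
      rwa [midpoint_self_neg] at this
    rcases (Finset.sum_nonneg fun i (_ : i ∈ Finset.univ) => abs_nonneg (x i)).eq_or_lt' with h | h
    · rw [Finset.sum_eq_zero_iff_of_nonneg fun i _ => abs_nonneg _] at h
      have : x = 0 := by ext i; simpa using h i (Finset.mem_univ i)
      rwa [this]
    · set s := ∑ i, |x i|
      let z : Fin n → EuclideanSpace ℝ (Fin n) := fun i =>
        if 0 ≤ x i then EuclideanSpace.single i 1 else -EuclideanSpace.single i 1
      have hz : ∑ i, (|x i| / s) • z i ∈ crossPolytope n := by
        refine hconv.sum_mem (fun i _ => by positivity) ?_ fun i _ => ?_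
        · rw [← Finset.sum_div, div_self h.ne']
        · simp only [z]; split_ifs
          exacts [hpos i, hneg i]
      have hxz : x = s • ∑ i, (|x i| / s) • z i := by
        ext j
        simp only [Finset.smul_sum, smul_smul, mul_div_cancel₀ _ h.ne', WithLp.ofLp_sum,
          Finset.sum_apply, PiLp.smul_apply, smul_eq_mul]
        rw [Finset.sum_eq_single j]
        · simp only [z]; split_ifs with hj
          · simp [abs_of_nonneg hj]
          · simp [abs_of_neg (not_le.1 hj)]
        · intro i _ hij
          simp only [z]; split_ifs <;> simp [hij]
        · simp
      rw [hxz]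
      exact hconv.smul_mem_of_zero_mem h0 hz ⟨h.le, hx⟩

theorem isCompact_crossPolytope (n : ℕ) : IsCompact (crossPolytope n) :=
  ((finite_range _).union (finite_range _)).isCompact_convexHull ℝ

theorem sum_abs_le_sqrt_mul_norm {n : ℕ} (x : EuclideanSpace ℝ (Fin n)) :
    ∑ i, |x i| ≤ √n * ‖x‖ := by
  rw [EuclideanSpace.norm_eq, ← Real.sqrt_mul (Nat.cast_nonneg n)]
  refine Real.le_sqrt_of_sq_le ?_
  have := sq_sum_le_card_mul_sum_sq (s := Finset.univ) (f := fun i => |x i|)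
  simpa using this

/-- The inner parallel domain at distance `ϱ` contains a smaller homothetic copy. -/
theorem mem_innerParallel_crossPolytope {n : ℕ} (hn : 0 < n) {ϱ : ℝ} (hϱ : 0 ≤ ϱ)
    {x : EuclideanSpace ℝ (Fin n)} (hx : ∑ i, |x i| ≤ 1 - √n * ϱ) :
    x ∈ innerParallel (crossPolytope n) ϱ := by
  have h : Metric.closedBall x ϱ ⊆ crossPolytope n := by
    intro y hy
    rw [crossPolytope_eq_setOf_sum_abs_le hn]
    show ∑ i, |y i| ≤ 1
    calc ∑ i, |y i| ≤ ∑ i, (|x i| + |(y - x) i|) :=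
          Finset.sum_le_sum fun i _ => by
            simpa using abs_add_le (x i) (y i - x i)
      _ ≤ (1 - √n * ϱ) + √n * ϱ := by
          rw [Finset.sum_add_distrib]
          refine add_le_add hx ((sum_abs_le_sqrt_mul_norm _).trans ?_)
          rw [mem_closedBall_iff_norm] at hy
          gcongr
      _ = 1 := by ring
  exact ⟨h (Metric.mem_closedBall_self hϱ), h⟩

theorem zero_mem_innerParallel_crossPolytope {n : ℕ} (hn : 0 < n) {ϱ : ℝ} (hϱ : 0 ≤ ϱ)
    (hϱn : ϱ ≤ 1 / √n) : 0 ∈ innerParallel (crossPolytope n) ϱ := by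
  refine mem_innerParallel_crossPolytope hn hϱ ?_
  have hs : 0 < √(n : ℝ) := by positivity
  rw [le_div_iff₀ hs] at hϱn
  simp only [PiLp.zero_apply, abs_zero, Finset.sum_const_zero]
  linarith

theorem volume_setOf_sum_abs_lt (k : ℕ) [NeZero k] {l : ℝ} (hl : 0 ≤ l) :
    volume {x : Fin k → ℝ | ∑ i, |x i| < l} = ENNReal.ofReal (l ^ k * (2 ^ k / k.factorial)) := by
  have := volume_sum_rpow_lt (Fin k) le_rfl l
  simp only [Real.rpow_one, div_one, Fintype.card_fin, Real.Gamma_nat_eq_factorial,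
    one_add_one_eq_two, Real.Gamma_two, mul_one] at this
  rw [this, ENNReal.ofReal_mul (by positivity), ENNReal.ofReal_pow hl]

theorem volume_setOf_sum_abs_le (k : ℕ) [NeZero k] {l : ℝ} (hl : 0 ≤ l) :
    volume {x : Fin k → ℝ | ∑ i, |x i| ≤ l} = ENNReal.ofReal (l ^ k * (2 ^ k / k.factorial)) := by
  have := volume_sum_rpow_le (Fin k) le_rfl l
  simp only [Real.rpow_one, div_one, Fintype.card_fin, Real.Gamma_nat_eq_factorial,
    one_add_one_eq_two, Real.Gamma_two, mul_one] at this
  rw [this, ENNReal.ofReal_mul (by positivity), ENNReal.ofReal_pow hl]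

theorem volume_crossPolytope (n : ℕ) [NeZero n] :
    volume (crossPolytope n) = ENNReal.ofReal (2 ^ n / n.factorial) := by
  have hmeas : MeasurableSet (crossPolytope n) := (isCompact_crossPolytope n).measurableSet
  rw [← (PiLp.volume_preserving_toLp (Fin n)).measure_preimage hmeas.nullMeasurableSet,
    crossPolytope_eq_setOf_sum_abs_le (NeZero.pos n)]
  have := volume_setOf_sum_abs_le n zero_le_one
  rw [one_pow, one_mul] at this
  exact this

/-! ### Moments of the improved gauge -/

theorem gaugeStar_eq_one {r : ℝ} (hr : r ≤ 2 - √2) : gaugeStar r = 1 := by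
  have h1 := one_le_sqrt_two
  rcases hr.eq_or_lt with rfl | hr
  · have h2 : (1 : ℝ) < √2 := Real.lt_sqrt_of_sq_lt (by norm_num)
    rw [gaugeStar_of_lt_one (by linarith), gaugeZero, if_pos (by linarith)]
    have : (2 - (2 - √2)) ^ 2 = (√2) ^ 2 := by ring
    rw [this, Real.sq_sqrt zero_le_two]; norm_num
  · rw [gaugeStar_of_lt_one (by linarith), gaugeZero, if_neg (by linarith)]; norm_num

theorem gaugeStar_eq_half_sq {r : ℝ} (h1 : 2 - √2 ≤ r) (h2 : r ≤ 1) :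
    gaugeStar r = (2 - r) ^ 2 / 2 := by
  rcases h2.eq_or_lt with rfl | h2
  · rw [gaugeStar_of_one_le le_rfl, gaugeZero_one]; norm_num
  · rw [gaugeStar_of_lt_one h2, gaugeZero, if_pos (by linarith)]; ring

theorem gaugeStar_eq_one_sub {r : ℝ} (h1 : 1 ≤ r) (h2 : r ≤ √2) :
    gaugeStar r = 1 - r ^ 2 / 2 := by
  rw [gaugeStar_of_one_le h1, gaugeZero, if_pos h2]

theorem intervalIntegrable_gaugeStar {a b : ℝ} (ha : 0 ≤ a) (hb : 0 ≤ b) :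
    IntervalIntegrable gaugeStar volume a b :=
  (gaugeStar_antitoneOn.mono fun _ hx => (le_min ha hb).trans hx.1).intervalIntegrable

theorem intervalIntegrable_mul_gaugeStar {a b : ℝ} (ha : 0 ≤ a) (hb : 0 ≤ b) :
    IntervalIntegrable (fun r => r * gaugeStar r) volume a b :=
  (intervalIntegrable_gaugeStar ha hb).continuousOn_mul continuousOn_id

theorem two_sub_sqrt_two_nonneg : 0 ≤ 2 - √2 := by
  have : √2 ≤ 2 := by rw [Real.sqrt_le_left (by norm_num)]; norm_num
  linarith

theorem integral_gaugeStar : ∫ r in (0 : ℝ)..√2, gaugeStar r = 1 := by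
  have h0 := two_sub_sqrt_two_nonneg
  have h1 := one_le_sqrt_two
  rw [← intervalIntegral.integral_add_adjacent_intervals (b := 1)
      (intervalIntegrable_gaugeStar le_rfl zero_le_one)
      (intervalIntegrable_gaugeStar zero_le_one (by positivity)),
    ← intervalIntegral.integral_add_adjacent_intervals (a := 0) (b := 2 - √2) (c := 1)
      (intervalIntegrable_gaugeStar le_rfl h0) (intervalIntegrable_gaugeStar h0 zero_le_one)]
  have e1 : ∫ r in (0 : ℝ)..(2 - √2), gaugeStar r = ∫ r in (0 : ℝ)..(2 - √2), (1 : ℝ) :=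
    intervalIntegral.integral_congr fun r hr => by
      rw [uIcc_of_le h0] at hr
      exact gaugeStar_eq_one hr.2
  have e2 : ∫ r in (2 - √2)..1, gaugeStar r = ∫ r in (2 - √2)..1, (2 - 2 * r + r ^ 2 / 2) :=
    intervalIntegral.integral_congr fun r hr => by
      rw [uIcc_of_le (by linarith)] at hr
      simp only [gaugeStar_eq_half_sq hr.1 hr.2]; ring
  have e3 : ∫ r in (1 : ℝ)..√2, gaugeStar r = ∫ r in (1 : ℝ)..√2, (1 - r ^ 2 / 2) :=
    intervalIntegral.integral_congr fun r hr => by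
      rw [uIcc_of_le h1] at hr
      exact gaugeStar_eq_one_sub hr.1 hr.2
  have d2 : ∀ r ∈ uIcc (2 - √2) 1,
      HasDerivAt (fun r : ℝ => 2 * r - r ^ 2 + r ^ 3 / 6) (2 - 2 * r + r ^ 2 / 2) r := by
    intro r _
    have := (((hasDerivAt_id r).const_mul 2).sub (hasDerivAt_pow 2 r)).add
      ((hasDerivAt_pow 3 r).div_const 6)
    convert! this using 1; simp; ring
  have d3 : ∀ r ∈ uIcc 1 √2, HasDerivAt (fun r : ℝ => r - r ^ 3 / 6) (1 - r ^ 2 / 2) r := by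
    intro r _
    have := (hasDerivAt_id r).sub ((hasDerivAt_pow 3 r).div_const 6)
    convert! this using 1; simp; ring
  rw [e1, e2, e3, intervalIntegral.integral_eq_sub_of_hasDerivAt d2
      (Continuous.intervalIntegrable (by fun_prop) _ _),
    intervalIntegral.integral_eq_sub_of_hasDerivAt d3
      (Continuous.intervalIntegrable (by fun_prop) _ _), intervalIntegral.integral_const]
  simp only [smul_eq_mul]
  ring_nf

/-- The first moment `∫ r f*(r) dr` of the improved gauge, about `0.531`. -/
noncomputable def gaugeMoment : ℝ := 29 / 12 - 4 / 3 * √2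

theorem integral_mul_gaugeStar : ∫ r in (0 : ℝ)..√2, r * gaugeStar r = gaugeMoment := by
  rw [gaugeMoment]
  have h0 := two_sub_sqrt_two_nonneg
  have h1 := one_le_sqrt_two
  rw [← intervalIntegral.integral_add_adjacent_intervals (b := 1)
      (intervalIntegrable_mul_gaugeStar le_rfl zero_le_one)
      (intervalIntegrable_mul_gaugeStar zero_le_one (by positivity)),
    ← intervalIntegral.integral_add_adjacent_intervals (a := 0) (b := 2 - √2) (c := 1)
      (intervalIntegrable_mul_gaugeStar le_rfl h0)
      (intervalIntegrable_mul_gaugeStar h0 zero_le_one)]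
  have e1 : ∫ r in (0 : ℝ)..(2 - √2), r * gaugeStar r = ∫ r in (0 : ℝ)..(2 - √2), r :=
    intervalIntegral.integral_congr fun r hr => by
      rw [uIcc_of_le h0] at hr
      simp only [gaugeStar_eq_one hr.2, mul_one]
  have e2 : ∫ r in (2 - √2)..1, r * gaugeStar r =
      ∫ r in (2 - √2)..1, (2 * r - 2 * r ^ 2 + r ^ 3 / 2) :=
    intervalIntegral.integral_congr fun r hr => by
      rw [uIcc_of_le (by linarith)] at hr
      simp only [gaugeStar_eq_half_sq hr.1 hr.2]; ring
  have e3 : ∫ r in (1 : ℝ)..√2, r * gaugeStar r = ∫ r in (1 : ℝ)..√2, (r - r ^ 3 / 2) :=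
    intervalIntegral.integral_congr fun r hr => by
      rw [uIcc_of_le h1] at hr
      simp only [gaugeStar_eq_one_sub hr.1 hr.2]; ring
  have d2 : ∀ r ∈ uIcc (2 - √2) 1,
      HasDerivAt (fun r : ℝ => r ^ 2 - r ^ 3 * (2 / 3) + r ^ 4 / 8)
        (2 * r - 2 * r ^ 2 + r ^ 3 / 2) r := by
    intro r _
    have := ((hasDerivAt_pow 2 r).sub ((hasDerivAt_pow 3 r).mul_const (2 / 3))).add
      ((hasDerivAt_pow 4 r).div_const 8)
    convert! this using 1; simp; ring
  have d3 : ∀ r ∈ uIcc 1 √2,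
      HasDerivAt (fun r : ℝ => r ^ 2 / 2 - r ^ 4 / 8) (r - r ^ 3 / 2) r := by
    intro r _
    have := ((hasDerivAt_pow 2 r).div_const 2).sub ((hasDerivAt_pow 4 r).div_const 8)
    convert! this using 1; simp; ring
  rw [e1, e2, e3, intervalIntegral.integral_eq_sub_of_hasDerivAt d2
      (Continuous.intervalIntegrable (by fun_prop) _ _),
    intervalIntegral.integral_eq_sub_of_hasDerivAt d3
      (Continuous.intervalIntegrable (by fun_prop) _ _), integral_id]
  have hs : √2 ^ 2 = 2 := Real.sq_sqrt zero_le_two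
  have hs3 : √2 ^ 3 = 2 * √2 := by rw [pow_succ, hs]
  have hs4 : √2 ^ 4 = 4 := by rw [show √2 ^ 4 = (√2 ^ 2) ^ 2 by ring, hs]; norm_num
  ring_nf
  rw [hs3, hs4, hs]; ring

theorem ofReal_integral_le_lintegral_Ioi {f : ℝ → ℝ} {b c : ℝ} (hb : 0 ≤ b) (hc : 0 < c)
    (hf : IntervalIntegrable f volume 0 b) (hf0 : ∀ r, 0 ≤ r → 0 ≤ f r) :
    ENNReal.ofReal (c⁻¹ * ∫ r in (0 : ℝ)..b, f r) ≤
      ∫⁻ t in Ioi (0 : ℝ), ENNReal.ofReal (f (c * t)) := by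
  have h1 : ∫ t in (0 : ℝ)..(b / c), f (c * t) = c⁻¹ * ∫ r in (0 : ℝ)..b, f r := by
    rw [intervalIntegral.integral_comp_mul_left _ hc.ne', mul_zero, mul_div_cancel₀ _ hc.ne',
      smul_eq_mul]
  have hbc : 0 ≤ b / c := by positivity
  have hint : IntegrableOn (fun t => f (c * t)) (Ioc 0 (b / c)) := by
    rw [← intervalIntegrable_iff_integrableOn_Ioc_of_le hbc]
    have := hf.comp_mul_left (c := c)
    simpa using this
  rw [← h1, intervalIntegral.integral_of_le hbc, ofReal_integral_eq_lintegral_ofReal hint]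
  · exact lintegral_mono_set fun t ht => ht.1
  · refine (ae_restrict_iff' measurableSet_Ioc).2 (Eventually.of_forall fun t ht => ?_)
    exact hf0 _ (mul_nonneg hc.le ht.1.le)

theorem lintegral_gaugeStar_ge {c : ℝ} (hc : 0 < c) :
    ENNReal.ofReal c⁻¹ ≤ ∫⁻ t in Ioi (0 : ℝ), ENNReal.ofReal (gaugeStar (c * t)) := by
  have := ofReal_integral_le_lintegral_Ioi (Real.sqrt_nonneg 2) hc
    (intervalIntegrable_gaugeStar le_rfl (by positivity)) fun r hr => gaugeStar_nonneg hr
  rwa [integral_gaugeStar, mul_one] at this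

theorem lintegral_mul_gaugeStar_ge {c : ℝ} (hc : 0 < c) :
    ENNReal.ofReal (gaugeMoment / c ^ 2) ≤
      ∫⁻ t in Ioi (0 : ℝ), ENNReal.ofReal (t * gaugeStar (c * t)) := by
  have := ofReal_integral_le_lintegral_Ioi (f := fun r => c⁻¹ * (r * gaugeStar r))
    (Real.sqrt_nonneg 2) hc
    ((intervalIntegrable_mul_gaugeStar le_rfl (by positivity)).const_mul c⁻¹)
    fun r hr => mul_nonneg (by positivity) (mul_nonneg hr (gaugeStar_nonneg hr))
  rw [intervalIntegral.integral_const_mul, integral_mul_gaugeStar] at this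
  have e1 : gaugeMoment / c ^ 2 = c⁻¹ * (c⁻¹ * gaugeMoment) := by
    field_simp
  have e2 (t : ℝ) : t * gaugeStar (c * t) = c⁻¹ * (c * t * gaugeStar (c * t)) := by
    field_simp
  simp_rw [e1, e2]
  exact this

/-- The numerical fact behind the restriction to dimension at least `7`. -/
theorem nine_div_seventeen_lt_gaugeMoment : 9 / 17 < gaugeMoment := by
  have : √2 < 1155 / 816 := by rw [Real.sqrt_lt' (by norm_num)]; norm_num
  rw [gaugeMoment]
  linarith

/-! ### Soft thresholding and the integral over the facet regions -/

theorem lintegral_eq_mul_lintegral_comp_affine {f : ℝ → ℝ≥0∞} (hf : Measurable f) {c : ℝ}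
    (hc : 0 < c) (d : ℝ) :
    ∫⁻ a, f a = ENNReal.ofReal c * ∫⁻ t, f (c * t + d) := by
  have h1 : ∫⁻ t, f (c * t + d) = ∫⁻ a, f (a + d) ∂(Measure.map (c * ·) volume) :=
    (lintegral_map (f := fun a => f (a + d)) (by fun_prop) (by fun_prop)).symm
  rw [h1, Real.map_volume_mul_left hc.ne', lintegral_smul_measure, lintegral_add_right_eq_self,
    smul_eq_mul, ← mul_assoc, ← ENNReal.ofReal_mul hc.le, abs_of_pos (inv_pos.2 hc),
    mul_inv_cancel₀ hc.ne', ENNReal.ofReal_one, one_mul]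

theorem lintegral_comp_abs_eq {f : ℝ → ℝ≥0∞} (hf : Measurable f) :
    ∫⁻ a, f |a| = 2 * ∫⁻ a in Ioi (0 : ℝ), f a := by
  rw [← lintegral_add_compl _ (measurableSet_Ioi (a := (0 : ℝ))), compl_Ioi, two_mul]
  congr 1
  · exact setLIntegral_congr_fun measurableSet_Ioi fun a ha => by simp [abs_of_pos ha.out]
  · have h := (Measure.measurePreserving_neg (volume : Measure ℝ)).setLIntegral_comp_preimage
      (measurableSet_Ici (a := (0 : ℝ))) hf
    rw [← restrict_Ioi_eq_restrict_Ici] at h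
    rw [← h]
    have e : (Neg.neg ⁻¹' Ici (0 : ℝ)) = Iic 0 := by ext; simp
    rw [e]
    exact setLIntegral_congr_fun measurableSet_Iic fun a ha => by simp [abs_of_nonpos ha.out]

/-- Soft thresholding on the line at level `t`: moving every point outside `[-t, t]` by `t` towards
the origin. -/
noncomputable def softThreshold (t a : ℝ) : ℝ := if 0 < a then a - t else a + t

theorem measurable_softThreshold (t : ℝ) : Measurable (softThreshold t) :=
  Measurable.ite measurableSet_Ioi (by fun_prop) (by fun_prop)

theorem abs_softThreshold {t a : ℝ} (h : t < |a|) : |softThreshold t a| = |a| - t := by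
  unfold softThreshold
  split_ifs with ha
  · rw [abs_of_pos ha] at h ⊢
    exact abs_of_pos (by linarith)
  · rw [abs_of_nonpos (not_lt.1 ha)] at h ⊢
    rw [abs_of_neg (by linarith)]; ring

theorem abs_sub_softThreshold {t : ℝ} (ht : 0 ≤ t) (a : ℝ) : |a - softThreshold t a| = t := by
  unfold softThreshold
  split_ifs
  · rw [sub_sub_cancel, abs_of_nonneg ht]
  · rw [sub_add_cancel_left, abs_neg, abs_of_nonneg ht]

theorem measurePreserving_softThreshold {t : ℝ} (ht : 0 ≤ t) :
    MeasurePreserving (softThreshold t) (volume.restrict {a | t < |a|}) volume := by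
  refine ⟨measurable_softThreshold t, ?_⟩
  have hset : {a : ℝ | t < |a|} = Ioi t ∪ Iio (-t) := by
    ext a; simp [lt_abs, lt_neg]
  have hdisj : Disjoint (Ioi t) (Iio (-t)) := by
    rw [Set.disjoint_left]; intro a ha hb
    have h1 : t < a := ha
    have h2 : a < -t := hb
    linarith
  have h1 : Measure.map (softThreshold t) (volume.restrict (Ioi t)) =
      volume.restrict (Ioi 0) := by
    have h := ((measurePreserving_sub_right volume t).restrict_preimage
      (measurableSet_Ioi (a := (0 : ℝ)))).map_eq
    have e : (fun x : ℝ => x - t) ⁻¹' Ioi 0 = Ioi t := by ext; simp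
    rw [e] at h
    rw [← h]
    refine Measure.map_congr ?_
    filter_upwards [ae_restrict_mem measurableSet_Ioi] with a ha
    exact if_pos (ht.trans_lt ha)
  have h2 : Measure.map (softThreshold t) (volume.restrict (Iio (-t))) =
      volume.restrict (Iio 0) := by
    have h := ((measurePreserving_add_right volume t).restrict_preimage
      (measurableSet_Iio (a := (0 : ℝ)))).map_eq
    have e : (fun x : ℝ => x + t) ⁻¹' Iio 0 = Iio (-t) := by
      ext; simp
    rw [e] at h
    rw [← h]
    refine Measure.map_congr ?_
    filter_upwards [ae_restrict_mem measurableSet_Iio] with a ha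
    have ha : a < -t := ha
    exact if_neg (by linarith)
  rw [hset, Measure.restrict_union hdisj measurableSet_Iio,
    Measure.map_add _ _ (measurable_softThreshold t), h1, h2,
    restrict_Iio_eq_restrict_Iic, add_comm]
  have := Measure.restrict_add_restrict_compl (μ := (volume : Measure ℝ))
    (measurableSet_Iic (a := (0 : ℝ)))
  rwa [compl_Iic] at this

/-- Cutting off all coordinates at level `t` and moving the pieces together turns a truncated
cross-polytope into a full one. -/
theorem volume_truncated_eq {k : ℕ} {t : ℝ} (ht : 0 ≤ t) (l : ℝ) :
    volume {y : Fin k → ℝ | (∀ j, t < |y j|) ∧ ∑ j, |y j| < k * t + l} =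
      volume {y : Fin k → ℝ | ∑ j, |y j| < l} := by
  have hmp := measurePreserving_pi (fun _ : Fin k => volume.restrict {a : ℝ | t < |a|})
    (fun _ : Fin k => volume) fun _ => measurePreserving_softThreshold ht
  have hmeas : MeasurableSet {y : Fin k → ℝ | ∑ j, |y j| < l} :=
    measurableSet_lt (by fun_prop) measurable_const
  rw [← volume_pi, ← Measure.restrict_pi_pi] at hmp
  have hpre := hmp.measure_preimage hmeas.nullMeasurableSet
  rw [Measure.restrict_apply (hmp.measurable hmeas), ← volume_pi] at hpre
  rw [← hpre]
  congr 1
  ext y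
  simp only [mem_ofPred_eq, mem_inter_iff, mem_preimage, mem_univ_pi]
  rw [and_comm]
  refine and_congr_left fun hy => ?_
  rw [Finset.sum_congr rfl fun j _ => abs_softThreshold (hy j), Finset.sum_sub_distrib,
    Finset.sum_const, Finset.card_univ, Fintype.card_fin, nsmul_eq_mul, sub_lt_iff_lt_add']

/-- The amount by which the absolute values of all coordinates of `x` have to be lowered for the
`ℓ¹`-norm to drop to `l`, provided none of them becomes negative. -/
noncomputable def excess {k : ℕ} (l : ℝ) (x : Fin k → ℝ) : ℝ := (∑ i, |x i| - l) / k

/-- The points outside the cross-polytope of `ℓ¹`-radius `l` whose nearest point in it lies in the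
relative interior of a facet. -/
def facetRegion (k : ℕ) (l : ℝ) : Set (Fin k → ℝ) :=
  {x | 0 < excess l x ∧ ∀ i, excess l x < |x i|}

theorem measurable_excess {k : ℕ} (l : ℝ) : Measurable (excess (k := k) l) := by
  unfold excess; fun_prop

theorem measurableSet_facetRegion (k : ℕ) (l : ℝ) : MeasurableSet (facetRegion k l) := by
  have : facetRegion k l = {x | 0 < excess l x} ∩ ⋂ i, {x | excess l x < |x i|} := by
    ext; simp [facetRegion]
  rw [this]
  exact (measurableSet_lt measurable_const (measurable_excess l)).inter
    (MeasurableSet.iInter fun i => measurableSet_lt (measurable_excess l) (by fun_prop))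

theorem lintegral_piFinSuccAbove {k : ℕ} (i : Fin (k + 1)) {Φ : ℝ × (Fin k → ℝ) → ℝ≥0∞}
    (hΦ : Measurable Φ) :
    ∫⁻ x : Fin (k + 1) → ℝ, Φ (x i, i.removeNth x) = ∫⁻ y, ∫⁻ a, Φ (a, y) := by
  rw [← lintegral_prod_symm' _ hΦ]
  exact (volume_preserving_piFinSuccAbove (fun _ : Fin (k + 1) => ℝ) i).lintegral_comp hΦ

/-- On the facet regions, the excess is distributed like a multiple of Lebesgue measure on the
half-line. -/
theorem lintegral_facetRegion (k : ℕ) (l : ℝ) {h : ℝ → ℝ≥0∞} (hh : Measurable h) :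
    ∫⁻ x in facetRegion (k + 1) l, h (excess l x) =
      2 * ENNReal.ofReal (k + 1) * volume {y : Fin k → ℝ | ∑ j, |y j| < l} *
        ∫⁻ t in Ioi (0 : ℝ), h t := by
  have hk : (0 : ℝ) < k + 1 := by positivity
  -- The condition on the remaining coordinate `a`, which enters through its absolute value.
  let T : Set (ℝ × ℝ × (Fin k → ℝ)) := {p | 0 < p.1 ∧ p.1 < p.2.1 ∧ ∀ j, p.1 < |p.2.2 j|}
  have hT : MeasurableSet T := by
    have : T = {p | 0 < p.1} ∩ ({p | p.1 < p.2.1} ∩ ⋂ j, {p | p.1 < |p.2.2 j|}) := by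
      ext; simp [T]
    rw [this]
    refine (measurableSet_lt (by fun_prop) (by fun_prop)).inter
      ((measurableSet_lt (by fun_prop) (by fun_prop)).inter
        (MeasurableSet.iInter fun j => measurableSet_lt (by fun_prop) (by fun_prop)))
  let τ : ℝ → (Fin k → ℝ) → ℝ := fun a y => (a + ∑ j, |y j| - l) / (k + 1)
  let Φ : ℝ → (Fin k → ℝ) → ℝ≥0∞ := fun a y => T.indicator (fun p => h p.1) (τ a y, a, y)
  have hΦ : Measurable (Function.uncurry Φ) := by
    refine ((hh.comp measurable_fst).indicator hT).comp (g := fun p => T.indicator _ p)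
      (f := fun q : ℝ × (Fin k → ℝ) => (τ q.1 q.2, q.1, q.2)) ?_
    simp only [τ]; fun_prop
  have step1 : ∫⁻ x in facetRegion (k + 1) l, h (excess l x) = ∫⁻ y, ∫⁻ a, Φ |a| y := by
    rw [← lintegral_indicator (measurableSet_facetRegion _ _),
      ← lintegral_piFinSuccAbove 0 (Φ := fun q => Φ |q.1| q.2)
        (hΦ.comp (f := fun q : ℝ × (Fin k → ℝ) => (|q.1|, q.2)) (by fun_prop))]
    refine lintegral_congr fun x => ?_
    have e : τ |x 0| ((0 : Fin (k + 1)).removeNth x) = excess l x := by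
      simp only [τ, excess, Fin.sum_univ_succ, Nat.cast_add, Nat.cast_one]
      rfl
    have e2 : x ∈ facetRegion (k + 1) l ↔
        (excess l x, |x 0|, (0 : Fin (k + 1)).removeNth x) ∈ T := by
      simp only [facetRegion, T, mem_ofPred_eq, Fin.forall_fin_succ]
      rfl
    simp only [Φ, e]
    by_cases hx : x ∈ facetRegion (k + 1) l
    · rw [indicator_of_mem hx, indicator_of_mem (e2.1 hx)]
    · rw [indicator_of_notMem hx, indicator_of_notMem (mt e2.2 hx)]
  have step2 (y : Fin k → ℝ) : ∫⁻ a, Φ |a| y =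
      2 * ENNReal.ofReal (k + 1) * ∫⁻ t, Φ ((k + 1) * t + (l - ∑ j, |y j|)) y := by
    have hy : Measurable fun a => Φ a y := hΦ.comp measurable_prodMk_right
    rw [lintegral_comp_abs_eq hy, mul_assoc, ← lintegral_eq_mul_lintegral_comp_affine hy hk]
    congr 1
    refine setLIntegral_eq_of_support_subset ?_
    intro a ha
    by_contra hc
    refine ha (indicator_of_notMem (fun hm => hc ?_) _)
    exact hm.1.trans hm.2.1
  -- In terms of the excess `t` as a variable, the constraint `t < a` is a bound on `∑ j, |y j|`.
  have step3 (t : ℝ) (y : Fin k → ℝ) : Φ ((k + 1) * t + (l - ∑ j, |y j|)) y =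
      (Ioi (0 : ℝ)).indicator h t *
        {y : Fin k → ℝ | (∀ j, t < |y j|) ∧ ∑ j, |y j| < k * t + l}.indicator 1 y := by
    have e : τ ((k + 1) * t + (l - ∑ j, |y j|)) y = t := by
      simp only [τ]; field_simp; ring
    simp only [Φ, e]
    by_cases ht : 0 < t
    · rw [indicator_of_mem (show t ∈ Ioi (0 : ℝ) from ht)]
      by_cases hy : (∀ j, t < |y j|) ∧ ∑ j, |y j| < k * t + l
      · rw [indicator_of_mem, indicator_of_mem]
        · simp
        · exact hy
        · exact ⟨ht, by simp only; linarith [hy.2], hy.1⟩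
      · rw [indicator_of_notMem, indicator_of_notMem, mul_zero]
        · exact hy
        · rintro ⟨-, h2, h3⟩
          exact hy ⟨h3, by simp only at h2; linarith⟩
    · rw [indicator_of_notMem, indicator_of_notMem, zero_mul]
      · exact ht
      · exact fun hm => ht hm.1
  have hm3 : Measurable fun q : (Fin k → ℝ) × ℝ => Φ ((k + 1) * q.2 + (l - ∑ j, |q.1 j|)) q.1 :=
    hΦ.comp (f := fun q : (Fin k → ℝ) × ℝ => ((k + 1) * q.2 + (l - ∑ j, |q.1 j|), q.1))
      (by fun_prop)
  have hmeas (t : ℝ) :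
      MeasurableSet {y : Fin k → ℝ | (∀ j, t < |y j|) ∧ ∑ j, |y j| < k * t + l} := by
    have : {y : Fin k → ℝ | (∀ j, t < |y j|) ∧ ∑ j, |y j| < k * t + l} =
        (⋂ j, {y | t < |y j|}) ∩ {y | ∑ j, |y j| < k * t + l} := by ext; simp
    rw [this]
    exact (MeasurableSet.iInter fun j => measurableSet_lt (by fun_prop) (by fun_prop)).inter
      (measurableSet_lt (by fun_prop) (by fun_prop))
  rw [step1, lintegral_congr step2, lintegral_const_mul _ hm3.lintegral_prod_right',
    lintegral_lintegral_swap hm3.aemeasurable, mul_assoc _ (volume _)]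
  congr 1
  have step4 (t : ℝ) : ∫⁻ y, Φ ((k + 1) * t + (l - ∑ j, |y j|)) y =
      volume {y : Fin k → ℝ | ∑ j, |y j| < l} * (Ioi (0 : ℝ)).indicator h t := by
    simp_rw [step3]
    rw [lintegral_const_mul _ (measurable_one.indicator (hmeas t)),
      lintegral_indicator_one (hmeas t), mul_comm]
    by_cases ht : 0 < t
    · rw [volume_truncated_eq ht.le]
    · rw [indicator_of_notMem (show t ∉ Ioi (0 : ℝ) from ht), mul_zero, mul_zero]
  rw [lintegral_congr step4, lintegral_const_mul _ (hh.indicator measurableSet_Ioi),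
    lintegral_indicator measurableSet_Ioi]

/-! ### The regions of points nearest to facets and to ridges -/

/-- The points whose nearest point in the cross-polytope of `ℓ¹`-radius `l` lies in the relative
interior of a ridge (a face of codimension two) contained in the hyperplane `x i = 0`. -/
def ridgeRegion {k : ℕ} (l : ℝ) (i : Fin (k + 1)) : Set (Fin (k + 1) → ℝ) :=
  {x | i.removeNth x ∈ facetRegion k l ∧ |x i| < excess l (i.removeNth x)}

section Regions

variable {k : ℕ} {l : ℝ}

theorem measurable_removeNth (i : Fin (k + 1)) :
    Measurable fun x : Fin (k + 1) → ℝ => i.removeNth x :=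
  measurable_pi_lambda _ fun j => measurable_pi_apply (i.succAbove j)

theorem measurableSet_ridgeRegion (i : Fin (k + 1)) : MeasurableSet (ridgeRegion l i) :=
  (measurable_removeNth i (measurableSet_facetRegion k l)).inter
    (measurableSet_lt (by fun_prop) ((measurable_excess l).comp (measurable_removeNth i)))

theorem mul_excess (hk : 0 < k) (l : ℝ) (x : Fin k → ℝ) :
    k * excess l x = ∑ i, |x i| - l := by
  have : (k : ℝ) ≠ 0 := by positivity
  rw [excess]; field_simp

theorem mul_excess_removeNth (hk : 0 < k) (l : ℝ) (i : Fin (k + 1)) (x : Fin (k + 1) → ℝ) :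
    k * excess l (i.removeNth x) = ∑ j, |x j| - |x i| - l := by
  rw [mul_excess hk, Fin.sum_univ_succAbove _ i]
  simp only [Fin.removeNth]
  ring

theorem excess_lt_of_mem_ridgeRegion {i j : Fin (k + 1)} {x : Fin (k + 1) → ℝ}
    (hx : x ∈ ridgeRegion l i) (hij : j ≠ i) : excess l (i.removeNth x) < |x j| := by
  obtain ⟨m, rfl⟩ := Fin.exists_succAbove_eq hij
  exact hx.1.2 m

theorem disjoint_facetRegion (hk : 0 < k) :
    Disjoint {x : Fin k → ℝ | ∑ i, |x i| < l} (facetRegion k l) := by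
  rw [Set.disjoint_left]
  intro x hx hx'
  have h1 := mul_excess hk l x
  have h2 : (0 : ℝ) < k * excess l x := mul_pos (by exact_mod_cast hk) hx'.1
  have h3 : ∑ i, |x i| < l := hx
  linarith

theorem disjoint_ridgeRegion (hk : 0 < k) (i : Fin (k + 1)) :
    Disjoint {x : Fin (k + 1) → ℝ | ∑ i, |x i| < l} (ridgeRegion l i) := by
  rw [Set.disjoint_left]
  intro x hx hx'
  have h1 := mul_excess_removeNth hk l i x
  have h2 : (0 : ℝ) < k * excess l (i.removeNth x) := mul_pos (by exact_mod_cast hk) hx'.1.1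
  have h3 : ∑ i, |x i| < l := hx
  linarith [abs_nonneg (x i)]

theorem disjoint_facetRegion_ridgeRegion (hk : 0 < k) (i : Fin (k + 1)) :
    Disjoint (facetRegion (k + 1) l) (ridgeRegion l i) := by
  rw [Set.disjoint_left]
  intro x hx hx'
  have h1 := mul_excess_removeNth hk l i x
  have h2 := mul_excess k.succ_pos l x
  push_cast at h2
  have h3 := hx.2 i
  have h4 := hx'.2
  have hk' : (0 : ℝ) < k := by exact_mod_cast hk
  nlinarith

theorem pairwise_disjoint_ridgeRegion (hk : 0 < k) :
    Pairwise (Function.onFun Disjoint (ridgeRegion (k := k) l)) := by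
  intro i j hij
  rw [Function.onFun, Set.disjoint_left]
  intro x hx hx'
  have h1 := mul_excess_removeNth hk l i x
  have h2 := mul_excess_removeNth hk l j x
  have h3 := excess_lt_of_mem_ridgeRegion hx hij.symm
  have h4 := excess_lt_of_mem_ridgeRegion hx' hij
  have h5 := hx.2
  have h6 := hx'.2
  have hk' : (0 : ℝ) < k := by exact_mod_cast hk
  nlinarith

end Regions

section Distance

variable {k : ℕ} {ϱ : ℝ}

theorem infDist_innerParallel_le {n : ℕ} (hn : 0 < n) (hϱ : 0 ≤ ϱ) (x y : Fin n → ℝ)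
    (hy : ∑ i, |y i| ≤ 1 - √n * ϱ) :
    Metric.infDist (WithLp.toLp 2 x) (innerParallel (crossPolytope n) ϱ) ≤
      √(∑ i, (x i - y i) ^ 2) := by
  refine (Metric.infDist_le_dist_of_mem
    (mem_innerParallel_crossPolytope (x := WithLp.toLp 2 y) hn hϱ hy)).trans_eq ?_
  rw [EuclideanSpace.dist_eq]
  simp [Real.dist_eq, sq_abs]

theorem sum_abs_softThreshold {x : Fin k → ℝ} (hk : 0 < k) {l : ℝ} (hx : x ∈ facetRegion k l) :
    ∑ i, |softThreshold (excess l x) (x i)| = l := by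
  rw [Finset.sum_congr rfl fun i _ => abs_softThreshold (hx.2 i), Finset.sum_sub_distrib,
    Finset.sum_const, Finset.card_univ, Fintype.card_fin, nsmul_eq_mul, mul_excess hk]
  ring

theorem infDist_le_of_mem_facetRegion (hk : 0 < k) (hϱ : 0 ≤ ϱ) {x : Fin k → ℝ}
    (hx : x ∈ facetRegion k (1 - √k * ϱ)) :
    Metric.infDist (WithLp.toLp 2 x) (innerParallel (crossPolytope k) ϱ) ≤
      √k * excess (1 - √k * ϱ) x := by
  refine (infDist_innerParallel_le hk hϱ x _ (sum_abs_softThreshold hk hx).le).trans_eq ?_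
  have h : ∀ i, (x i - softThreshold (excess (1 - √k * ϱ) x) (x i)) ^ 2 =
      excess (1 - √k * ϱ) x ^ 2 := fun i => by
    rw [← sq_abs, abs_sub_softThreshold hx.1.le]
  rw [Finset.sum_congr rfl fun i _ => h i, Finset.sum_const, Finset.card_univ, Fintype.card_fin,
    nsmul_eq_mul, Real.sqrt_mul (Nat.cast_nonneg k), Real.sqrt_sq hx.1.le]

theorem infDist_le_of_mem_ridgeRegion (hk : 0 < k) (hϱ : 0 ≤ ϱ) {x : Fin (k + 1) → ℝ}
    {i : Fin (k + 1)} (hx : x ∈ ridgeRegion (1 - √(k + 1 : ℕ) * ϱ) i) :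
    Metric.infDist (WithLp.toLp 2 x) (innerParallel (crossPolytope (k + 1)) ϱ) ≤
      √(x i ^ 2 + k * excess (1 - √(k + 1 : ℕ) * ϱ) (i.removeNth x) ^ 2) := by
  set l := 1 - √(k + 1 : ℕ) * ϱ
  let y : Fin (k + 1) → ℝ :=
    i.insertNth 0 fun j => softThreshold (excess l (i.removeNth x)) (i.removeNth x j)
  have hy : ∑ j, |y j| ≤ l := by
    rw [Fin.sum_univ_succAbove _ i]
    simp only [y, Fin.insertNth_apply_same, Fin.insertNth_apply_succAbove, abs_zero, zero_add]
    exact (sum_abs_softThreshold hk hx.1).le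
  refine (infDist_innerParallel_le k.succ_pos hϱ x y hy).trans_eq ?_
  rw [Fin.sum_univ_succAbove _ i]
  simp only [y, Fin.insertNth_apply_same, Fin.insertNth_apply_succAbove, sub_zero]
  have h : ∀ j, (x (i.succAbove j) -
      softThreshold (excess l (i.removeNth x)) (i.removeNth x j)) ^ 2 =
      excess l (i.removeNth x) ^ 2 := fun j => by
    rw [← sq_abs]
    exact congrArg (· ^ 2) (abs_sub_softThreshold hx.1.1.le (i.removeNth x j))
  rw [Finset.sum_congr rfl fun j _ => h j, Finset.sum_const, Finset.card_univ, Fintype.card_fin,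
    nsmul_eq_mul]

end Distance

/-! ### The contributions of the facet and ridge regions -/

section Contributions

variable {k : ℕ} {ϱ : ℝ}

/-- The value of the gauge function of the cross-polytope at a point. -/
noncomputable def crossGauge (n : ℕ) (ϱ : ℝ) (x : Fin n → ℝ) : ℝ≥0∞ :=
  ENNReal.ofReal (gaugeStar
    (Metric.infDist (WithLp.toLp 2 x) (innerParallel (crossPolytope n) ϱ) / ϱ))

theorem lintegral_crossGauge (n : ℕ) (ϱ : ℝ) :
    ∫⁻ x, crossGauge n ϱ x = gaugeIntegral gaugeStar (crossPolytope n) ϱ :=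
  (PiLp.volume_preserving_toLp (Fin n)).lintegral_comp (measurable_gaugeStar_infDist _ ϱ)

theorem le_crossGauge {n : ℕ} (hϱ : 0 < ϱ) {x : Fin n → ℝ} {d : ℝ}
    (h : Metric.infDist (WithLp.toLp 2 x) (innerParallel (crossPolytope n) ϱ) ≤ d) :
    ENNReal.ofReal (gaugeStar (d / ϱ)) ≤ crossGauge n ϱ x := by
  refine ENNReal.ofReal_le_ofReal (gaugeStar_antitoneOn ?_ ?_ (by gcongr))
  · exact div_nonneg Metric.infDist_nonneg hϱ.le
  · exact div_nonneg (Metric.infDist_nonneg.trans h) hϱ.le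

theorem lintegral_core_ge {n : ℕ} [NeZero n] (hϱ : 0 < ϱ) (hl : 0 ≤ 1 - √n * ϱ) :
    ENNReal.ofReal ((1 - √n * ϱ) ^ n * (2 ^ n / n.factorial)) ≤
      ∫⁻ x in {x : Fin n → ℝ | ∑ i, |x i| < 1 - √n * ϱ}, crossGauge n ϱ x := by
  have hmeas : MeasurableSet {x : Fin n → ℝ | ∑ i, |x i| < 1 - √n * ϱ} :=
    measurableSet_lt (by fun_prop) measurable_const
  rw [← volume_setOf_sum_abs_lt n hl, ← setLIntegral_one]
  refine setLIntegral_mono' hmeas fun x hx => ?_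
  have h := infDist_innerParallel_le (NeZero.pos n) hϱ.le x x (le_of_lt hx)
  have := le_crossGauge hϱ h
  rwa [show √(∑ i, (x i - x i) ^ 2) / ϱ = 0 by simp,
    gaugeStar_eq_one two_sub_sqrt_two_nonneg, ENNReal.ofReal_one] at this

theorem lintegral_facetRegion_ge [NeZero k] (hϱ : 0 < ϱ) (hl : 0 ≤ 1 - √(k + 1 : ℕ) * ϱ) :
    ENNReal.ofReal (2 * (k + 1) * ((1 - √(k + 1 : ℕ) * ϱ) ^ k * (2 ^ k / k.factorial)) *
        (ϱ / √(k + 1 : ℕ))) ≤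
      ∫⁻ x in facetRegion (k + 1) (1 - √(k + 1 : ℕ) * ϱ), crossGauge (k + 1) ϱ x := by
  set l := 1 - √(k + 1 : ℕ) * ϱ
  have hn : (0 : ℝ) < √(k + 1 : ℕ) := by positivity
  calc _ = 2 * ENNReal.ofReal (k + 1) * volume {y : Fin k → ℝ | ∑ j, |y j| < l} *
          ENNReal.ofReal (√(k + 1 : ℕ) / ϱ)⁻¹ := by
        rw [volume_setOf_sum_abs_lt k hl, ← ENNReal.ofReal_ofNat 2,
          ← ENNReal.ofReal_mul (by positivity), ← ENNReal.ofReal_mul (by positivity),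
          ← ENNReal.ofReal_mul (by positivity), inv_div]
    _ ≤ 2 * ENNReal.ofReal (k + 1) * volume {y : Fin k → ℝ | ∑ j, |y j| < l} *
          ∫⁻ t in Ioi (0 : ℝ), ENNReal.ofReal (gaugeStar (√(k + 1 : ℕ) / ϱ * t)) := by
        gcongr
        exact lintegral_gaugeStar_ge (by positivity)
    _ = ∫⁻ x in facetRegion (k + 1) l,
          ENNReal.ofReal (gaugeStar (√(k + 1 : ℕ) / ϱ * excess l x)) := by
        refine (lintegral_facetRegion k l ?_).symm
        exact (measurable_gaugeStar.comp (by fun_prop)).ennreal_ofReal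
    _ ≤ _ := by
        refine setLIntegral_mono' (measurableSet_facetRegion _ _) fun x hx => ?_
        rw [div_mul_eq_mul_div]
        exact le_crossGauge hϱ (infDist_le_of_mem_facetRegion k.succ_pos hϱ.le hx)

/-- The two-dimensional integral of the gauge over the normal cone of a ridge, in the coordinates
`t` and `w = s t`, for which the cone is `|s| < 1`. The bound `1 / (m + s²) ≥ 1 / m - s² / m²`
replaces the exact value, which involves an arctangent. -/
theorem lintegral_normalCone_ge {m : ℝ} (hm1 : 1 ≤ m) (hϱ : 0 < ϱ) :
    ENNReal.ofReal (gaugeMoment * ϱ ^ 2 * (2 / m * (1 - 1 / (3 * m)))) ≤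
      ∫⁻ t in Ioi (0 : ℝ), ∫⁻ w in Ioo (-t) t,
        ENNReal.ofReal (gaugeStar (√(w ^ 2 + m * t ^ 2) / ϱ)) := by
  have hm : 0 < m := one_pos.trans_le hm1
  have hI : 0 < gaugeMoment := lt_trans (by norm_num) nine_div_seventeen_lt_gaugeMoment
  have hinner (t : ℝ) (ht : 0 < t) :
      ∫⁻ w in Ioo (-t) t, ENNReal.ofReal (gaugeStar (√(w ^ 2 + m * t ^ 2) / ϱ)) =
        ∫⁻ s in Ioo (-1 : ℝ) 1, ENNReal.ofReal (t * gaugeStar (√(s ^ 2 + m) / ϱ * t)) := by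
    have hf : Measurable fun w => ENNReal.ofReal (gaugeStar (√(w ^ 2 + m * t ^ 2) / ϱ)) :=
      (measurable_gaugeStar.comp (by fun_prop)).ennreal_ofReal
    have hf' : Measurable fun s => ENNReal.ofReal (gaugeStar (√(s ^ 2 + m) / ϱ * t)) :=
      (measurable_gaugeStar.comp (by fun_prop)).ennreal_ofReal
    simp_rw [ENNReal.ofReal_mul ht.le]
    rw [← lintegral_indicator measurableSet_Ioo,
      lintegral_eq_mul_lintegral_comp_affine (hf.indicator measurableSet_Ioo) ht 0,
      lintegral_const_mul _ hf', ← lintegral_indicator measurableSet_Ioo]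
    congr 1
    refine lintegral_congr fun s => ?_
    have hmem : t * s + 0 ∈ Ioo (-t) t ↔ s ∈ Ioo (-1 : ℝ) 1 := by
      simp only [mem_Ioo, add_zero]
      constructor
      · rintro ⟨h1, h2⟩; constructor <;> nlinarith
      · rintro ⟨h1, h2⟩; constructor <;> nlinarith
    by_cases hs : s ∈ Ioo (-1 : ℝ) 1
    · rw [indicator_of_mem hs, indicator_of_mem (hmem.2 hs)]
      rw [show (t * s + 0) ^ 2 + m * t ^ 2 = (s ^ 2 + m) * t ^ 2 by ring,
        Real.sqrt_mul (by positivity), Real.sqrt_sq ht.le, div_mul_eq_mul_div]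
    · rw [indicator_of_notMem hs, indicator_of_notMem (mt hmem.1 hs)]
  rw [setLIntegral_congr_fun measurableSet_Ioi fun t ht => hinner t ht,
    lintegral_lintegral_swap]
  swap
  · refine Measurable.aemeasurable ?_
    refine Measurable.ennreal_ofReal ?_
    exact measurable_fst.mul (measurable_gaugeStar.comp
      (f := fun q : ℝ × ℝ => √(q.2 ^ 2 + m) / ϱ * q.1) (by fun_prop))
  have hint : ∫ s in (-1 : ℝ)..1, gaugeMoment * ϱ ^ 2 * (1 / m - s ^ 2 / m ^ 2) =
      gaugeMoment * ϱ ^ 2 * (2 / m * (1 - 1 / (3 * m))) := by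
    rw [intervalIntegral.integral_const_mul, intervalIntegral.integral_sub
      (Continuous.intervalIntegrable (by fun_prop) _ _)
      (Continuous.intervalIntegrable (by fun_prop) _ _), intervalIntegral.integral_const,
      intervalIntegral.integral_div, integral_pow]
    simp only [smul_eq_mul]
    field_simp
    ring
  have hpt (s : ℝ) : gaugeMoment * ϱ ^ 2 * (1 / m - s ^ 2 / m ^ 2) ≤
      gaugeMoment / (√(s ^ 2 + m) / ϱ) ^ 2 := by
    rw [div_pow, Real.sq_sqrt (by positivity), div_div_eq_mul_div, mul_div_assoc]
    rw [mul_assoc]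
    gcongr
    have : ϱ ^ 2 / (s ^ 2 + m) = ϱ ^ 2 * (1 / (s ^ 2 + m)) := by ring
    rw [this]
    gcongr
    rw [le_div_iff₀ (by positivity)]
    have : (1 / m - s ^ 2 / m ^ 2) * (s ^ 2 + m) = 1 - (s ^ 2 / m) ^ 2 := by field_simp; ring
    rw [this]
    nlinarith [sq_nonneg (s ^ 2 / m)]
  rw [← hint, intervalIntegral.integral_of_le (by norm_num)]
  rw [ofReal_integral_eq_lintegral_ofReal, ← restrict_Ioo_eq_restrict_Ioc]
  · refine lintegral_mono fun s => (ENNReal.ofReal_le_ofReal (hpt s)).trans ?_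
    exact lintegral_mul_gaugeStar_ge (by positivity)
  · exact (Continuous.integrableOn_Icc (by fun_prop)).mono_set Ioc_subset_Icc_self
  · refine (ae_restrict_iff' measurableSet_Ioc).2 (Eventually.of_forall fun s hs => ?_)
    have h1 : s ^ 2 ≤ m := by nlinarith [hs.1, hs.2]
    have h2 : 1 / m - s ^ 2 / m ^ 2 = (m - s ^ 2) / m ^ 2 := by field_simp
    simp only [Pi.zero_apply, h2]
    exact mul_nonneg (by positivity) (div_nonneg (sub_nonneg.2 h1) (by positivity))

theorem lintegral_ridgeRegion_ge [NeZero k] (hϱ : 0 < ϱ) (hl : 0 ≤ 1 - √(k + 2 : ℕ) * ϱ)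
    (i : Fin (k + 2)) :
    ENNReal.ofReal (2 * (k + 1) * ((1 - √(k + 2 : ℕ) * ϱ) ^ k * (2 ^ k / k.factorial)) *
        (gaugeMoment * ϱ ^ 2 * (2 / (k + 1) * (1 - 1 / (3 * (k + 1)))))) ≤
      ∫⁻ x in ridgeRegion (1 - √(k + 2 : ℕ) * ϱ) i, crossGauge (k + 2) ϱ x := by
  set l := 1 - √(k + 2 : ℕ) * ϱ with hldef
  let g : ℝ → ℝ → ℝ≥0∞ := fun t w =>
    (Ioo (-t) t).indicator (fun w =>
      ENNReal.ofReal (gaugeStar (√(w ^ 2 + (k + 1) * t ^ 2) / ϱ))) w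
  have hg : Measurable (Function.uncurry g) := by
    have h1 : MeasurableSet {q : ℝ × ℝ | -q.1 < q.2} :=
      measurableSet_lt (by fun_prop) (by fun_prop)
    have h2 : MeasurableSet {q : ℝ × ℝ | q.2 < q.1} :=
      measurableSet_lt (by fun_prop) (by fun_prop)
    have hS : MeasurableSet {q : ℝ × ℝ | q.2 ∈ Ioo (-q.1) q.1} := h1.inter h2
    have hF : Measurable fun q : ℝ × ℝ =>
        ENNReal.ofReal (gaugeStar (√(q.2 ^ 2 + (k + 1) * q.1 ^ 2) / ϱ)) :=
      (measurable_gaugeStar.comp (by fun_prop)).ennreal_ofReal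
    exact hF.indicator hS
  have hgm : Measurable fun t => ∫⁻ w, g t w := hg.lintegral_prod_right'
  have hcone : ENNReal.ofReal
      (gaugeMoment * ϱ ^ 2 * (2 / (k + 1) * (1 - 1 / (3 * (k + 1))))) ≤
      ∫⁻ t in Ioi (0 : ℝ), ∫⁻ w, g t w := by
    refine (lintegral_normalCone_ge (m := k + 1) (by simp) hϱ).trans_eq ?_
    refine lintegral_congr fun t => ?_
    rw [← lintegral_indicator measurableSet_Ioo]
  calc _ = 2 * ENNReal.ofReal (k + 1) * volume {y : Fin k → ℝ | ∑ j, |y j| < l} *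
          ENNReal.ofReal (gaugeMoment * ϱ ^ 2 * (2 / (k + 1) * (1 - 1 / (3 * (k + 1))))) := by
        rw [volume_setOf_sum_abs_lt k hl, ← ENNReal.ofReal_ofNat 2,
          ← ENNReal.ofReal_mul (by positivity), ← ENNReal.ofReal_mul (by positivity),
          ← ENNReal.ofReal_mul (by positivity)]
    _ ≤ 2 * ENNReal.ofReal (k + 1) * volume {y : Fin k → ℝ | ∑ j, |y j| < l} *
          ∫⁻ t in Ioi (0 : ℝ), ∫⁻ w, g t w := by gcongr
    _ = ∫⁻ y in facetRegion (k + 1) l, ∫⁻ w, g (excess l y) w :=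
        (lintegral_facetRegion k l hgm).symm
    _ = ∫⁻ y, ∫⁻ w, (facetRegion (k + 1) l).indicator (fun y => g (excess l y) w) y := by
        rw [← lintegral_indicator (measurableSet_facetRegion _ _)]
        refine lintegral_congr fun y => ?_
        by_cases hy : y ∈ facetRegion (k + 1) l
        · simp only [indicator_of_mem hy]
        · simp only [indicator_of_notMem hy, lintegral_zero]
    _ = ∫⁻ x : Fin (k + 2) → ℝ, (facetRegion (k + 1) l).indicator
          (fun y => g (excess l y) (x i)) (i.removeNth x) := by
        refine (lintegral_piFinSuccAbove i (Φ := fun q : ℝ × (Fin (k + 1) → ℝ) =>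
          (facetRegion (k + 1) l).indicator (fun y => g (excess l y) q.1) q.2) ?_).symm
        have hF : Measurable fun q : ℝ × (Fin (k + 1) → ℝ) => g (excess l q.2) q.1 :=
          hg.comp (((measurable_excess l).comp measurable_snd).prodMk measurable_fst)
        exact hF.indicator (measurable_snd (measurableSet_facetRegion (k + 1) l))
    _ ≤ _ := by
        rw [← lintegral_indicator (measurableSet_ridgeRegion i)]
        refine lintegral_mono fun x => ?_
        by_cases hx : x ∈ ridgeRegion l i
        · rw [indicator_of_mem hx, indicator_of_mem hx.1]
          simp only [g]
          rw [indicator_of_mem (show x i ∈ Ioo _ _ from abs_lt.1 hx.2)]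
          have := infDist_le_of_mem_ridgeRegion (k := k + 1) k.succ_pos hϱ.le hx
          rw [Nat.cast_succ] at this
          exact le_crossGauge hϱ this
        · rw [indicator_of_notMem hx, nonpos_iff_eq_zero, indicator_apply_eq_zero]
          intro h1
          exact indicator_of_notMem (s := Ioo _ _) (fun h2 => hx ⟨h1, abs_lt.2 h2⟩) _

end Contributions

/-! ### Comparison with the volume of the cross-polytope -/

/-- The second-order lower bound for `G(ϱ)`: the contributions of the inner cross-polytope, of the
facets and of the ridges. -/
theorem gaugeIntegral_crossPolytope_ge (k : ℕ) [NeZero k] {ϱ : ℝ} (hϱ : 0 < ϱ)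
    (hl : 0 ≤ 1 - √(k + 2 : ℕ) * ϱ) :
    ENNReal.ofReal ((1 - √(k + 2 : ℕ) * ϱ) ^ (k + 2) * (2 ^ (k + 2) / (k + 2).factorial) +
      2 * ((k + 1 : ℕ) + 1) * ((1 - √(k + 2 : ℕ) * ϱ) ^ (k + 1) *
        (2 ^ (k + 1) / (k + 1).factorial)) * (ϱ / √(k + 2 : ℕ)) +
      (k + 2) * (2 * (k + 1) * ((1 - √(k + 2 : ℕ) * ϱ) ^ k * (2 ^ k / k.factorial)) *
        (gaugeMoment * ϱ ^ 2 * (2 / (k + 1) * (1 - 1 / (3 * (k + 1))))))) ≤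
      gaugeIntegral gaugeStar (crossPolytope (k + 2)) ϱ := by
  set l := 1 - √(k + 2 : ℕ) * ϱ
  set F := crossGauge (k + 2) ϱ
  have hI : 0 < gaugeMoment := lt_trans (by norm_num) nine_div_seventeen_lt_gaugeMoment
  have h13 : (0 : ℝ) ≤ 1 - 1 / (3 * (k + 1)) := by
    rw [sub_nonneg, div_le_one (by positivity)]
    linarith [(Nat.cast_nonneg k : (0 : ℝ) ≤ k)]
  have hfacet := lintegral_facetRegion_ge (k := k + 1) hϱ hl
  have hsum : ∑ i : Fin (k + 2), ∫⁻ x in ridgeRegion l i, F x ≥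
      ENNReal.ofReal ((k + 2) * (2 * (k + 1) * (l ^ k * (2 ^ k / k.factorial)) *
        (gaugeMoment * ϱ ^ 2 * (2 / (k + 1) * (1 - 1 / (3 * (k + 1))))))) := by
    refine le_trans (le_of_eq ?_)
      (Finset.sum_le_sum fun i _ => lintegral_ridgeRegion_ge (k := k) hϱ hl i)
    rw [Finset.sum_const, Finset.card_univ, Fintype.card_fin, nsmul_eq_mul,
      ENNReal.ofReal_mul (p := (k : ℝ) + 2) (by positivity)]
    congr 1
    rw [← ENNReal.ofReal_natCast]
    congr 1
    push_cast; ring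
  have hm := measurableSet_facetRegion (k + 2) l
  have hmr : MeasurableSet (⋃ i : Fin (k + 2), ridgeRegion l i) :=
    MeasurableSet.iUnion fun i => measurableSet_ridgeRegion i
  have hd1 : Disjoint ({x : Fin (k + 2) → ℝ | ∑ i, |x i| < l} ∪ facetRegion (k + 2) l)
      (⋃ i : Fin (k + 2), ridgeRegion l i) :=
    disjoint_iUnion_right.2 fun i => (disjoint_ridgeRegion k.succ_pos i).union_left
      (disjoint_facetRegion_ridgeRegion k.succ_pos i)
  calc _ = ENNReal.ofReal (l ^ (k + 2) * (2 ^ (k + 2) / (k + 2).factorial)) +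
        ENNReal.ofReal (2 * ((k + 1 : ℕ) + 1) * (l ^ (k + 1) *
          (2 ^ (k + 1) / (k + 1).factorial)) * (ϱ / √(k + 2 : ℕ))) +
        ENNReal.ofReal ((k + 2) * (2 * (k + 1) * (l ^ k * (2 ^ k / k.factorial)) *
          (gaugeMoment * ϱ ^ 2 * (2 / (k + 1) * (1 - 1 / (3 * (k + 1))))))) := by
        rw [ENNReal.ofReal_add, ENNReal.ofReal_add] <;> positivity
    _ ≤ (∫⁻ x in {x : Fin (k + 2) → ℝ | ∑ i, |x i| < l}, F x) +
        (∫⁻ x in facetRegion (k + 2) l, F x) + ∑ i : Fin (k + 2), ∫⁻ x in ridgeRegion l i, F x :=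
        add_le_add (add_le_add (lintegral_core_ge hϱ hl) hfacet) hsum
    _ = ∫⁻ x in ({x : Fin (k + 2) → ℝ | ∑ i, |x i| < l} ∪ facetRegion (k + 2) l) ∪
          ⋃ i : Fin (k + 2), ridgeRegion l i, F x := by
        rw [lintegral_union hmr hd1, lintegral_union hm (disjoint_facetRegion (by omega)),
          lintegral_iUnion (fun i => measurableSet_ridgeRegion i)
            (pairwise_disjoint_ridgeRegion k.succ_pos), tsum_fintype]
    _ ≤ ∫⁻ x, F x := setLIntegral_le_lintegral _ _
    _ = _ := lintegral_crossGauge _ _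

/-- The first three terms of the binomial expansion of `(x + (1 - x)) ^ (k + 2)` add up to `1` up
to an error of third order. -/
theorem exists_one_sub_mul_cube_le (k : ℕ) : ∃ C : ℝ, 0 < C ∧ ∀ x : ℝ, 0 ≤ x → x ≤ 1 →
    1 - C * x ^ 3 ≤ (1 - x) ^ (k + 2) + (k + 2) * x * (1 - x) ^ (k + 1) +
      (k + 2) * (k + 1) / 2 * x ^ 2 * (1 - x) ^ k := by
  induction k with
  | zero =>
    refine ⟨1, one_pos, fun x hx _ => ?_⟩
    norm_num
    nlinarith [pow_nonneg hx 3]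
  | succ k ih =>
    obtain ⟨C, hC, h⟩ := ih
    refine ⟨C + (k + 2) * (k + 1) / 2, by positivity, fun x hx hx1 => ?_⟩
    have h1 : (1 - x) ^ k ≤ 1 := pow_le_one₀ (by linarith) (by linarith)
    have h2 : (k + 2) * (k + 1) / 2 * x ^ 3 * (1 - x) ^ k ≤
        (k + 2 : ℝ) * (k + 1) / 2 * x ^ 3 := mul_le_of_le_one_right (by positivity) h1
    have h3 := h x hx hx1
    have e : (1 - x) ^ (k + 1 + 2) + ((k + 1 : ℕ) + 2) * x * (1 - x) ^ (k + 1 + 1) +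
        ((k + 1 : ℕ) + 2) * ((k + 1 : ℕ) + 1) / 2 * x ^ 2 * (1 - x) ^ (k + 1) =
        (1 - x) ^ (k + 2) + (k + 2) * x * (1 - x) ^ (k + 1) +
          (k + 2) * (k + 1) / 2 * x ^ 2 * (1 - x) ^ k -
          (k + 2) * (k + 1) / 2 * x ^ 3 * (1 - x) ^ k := by
      push_cast; ring
    rw [e]
    linarith

/-- Any coefficient above `1 / 2` in the second-order term outweighs the error for small `x`. -/
theorem eventually_one_lt_of_half_lt (k : ℕ) {κ : ℝ} (hκ : 1 / 2 < κ) :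
    ∀ᶠ x in 𝓝[>] (0 : ℝ), 1 < (1 - x) ^ (k + 2) + (k + 2) * x * (1 - x) ^ (k + 1) +
      κ * ((k + 2) * (k + 1)) * x ^ 2 * (1 - x) ^ k := by
  obtain ⟨C, hC, h⟩ := exists_one_sub_mul_cube_le k
  set δ := (κ - 1 / 2) * ((k + 2) * (k + 1)) with hδ
  have hδ0 : 0 < δ := mul_pos (by linarith) (by positivity)
  have hlim : Tendsto (fun x : ℝ => δ * (1 - x) ^ k - C * x) (𝓝[>] 0) (𝓝 δ) := by
    have : ContinuousAt (fun x : ℝ => δ * (1 - x) ^ k - C * x) 0 := by fun_prop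
    have h0 := this.tendsto
    simp only [sub_zero, one_pow, mul_one, mul_zero] at h0
    exact h0.mono_left nhdsWithin_le_nhds
  filter_upwards [hlim.eventually (lt_mem_nhds hδ0), self_mem_nhdsWithin,
    Ioo_mem_nhdsGT (zero_lt_one (α := ℝ))] with x hx h0 h1
  have h0 : 0 < x := h0
  have h2 := h x h0.le h1.2.le
  have h3 : 0 < x ^ 2 * (δ * (1 - x) ^ k - C * x) := by positivity
  have e : κ * ((k + 2) * (k + 1)) * x ^ 2 * (1 - x) ^ k =
      (k + 2) * (k + 1) / 2 * x ^ 2 * (1 - x) ^ k + δ * x ^ 2 * (1 - x) ^ k := by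
    rw [hδ]; ring
  rw [e]
  linarith

/-- For small `ϱ` the gauge integral exceeds the volume. The condition `7 ≤ n` makes the second-order
coefficient `gaugeMoment * (1 - 1 / (3 (n - 1)))` larger than `1 / 2`. -/
theorem eventually_volume_lt_gaugeIntegral {n : ℕ} (hn : 7 ≤ n) :
    ∀ᶠ ϱ in 𝓝[>] (0 : ℝ),
      volume (crossPolytope n) < gaugeIntegral gaugeStar (crossPolytope n) ϱ := by
  obtain ⟨k, rfl⟩ : ∃ k, n = k + 2 := ⟨n - 2, by omega⟩
  have : NeZero k := ⟨by omega⟩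
  have hk : (5 : ℝ) ≤ k := by exact_mod_cast (show 5 ≤ k by omega)
  set κ := gaugeMoment * (1 - 1 / (3 * (k + 1))) with hκdef
  have hκ : 1 / 2 < κ := by
    have h1 : (1 : ℝ) / (3 * (k + 1)) ≤ 1 / 18 := by
      gcongr
      linarith
    have h2 := nine_div_seventeen_lt_gaugeMoment
    have h3 : gaugeMoment * (17 / 18) ≤ κ := by
      refine mul_le_mul_of_nonneg_left (by linarith) (by linarith)
    linarith
  have hs : (0 : ℝ) < √(k + 2 : ℕ) := by positivity
  have hlim : Tendsto (fun ϱ : ℝ => √(k + 2 : ℕ) * ϱ) (𝓝[>] 0) (𝓝[>] 0) := by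
    refine tendsto_nhdsWithin_iff.2 ⟨?_, ?_⟩
    · have : Tendsto (fun ϱ : ℝ => √(k + 2 : ℕ) * ϱ) (𝓝 0) (𝓝 (√(k + 2 : ℕ) * 0)) :=
        tendsto_id.const_mul _
      rw [mul_zero] at this
      exact this.mono_left nhdsWithin_le_nhds
    · filter_upwards [self_mem_nhdsWithin] with ϱ hϱ
      exact mul_pos hs hϱ
  filter_upwards [hlim.eventually (eventually_one_lt_of_half_lt k hκ), self_mem_nhdsWithin,
    hlim.eventually (Ioo_mem_nhdsGT (zero_lt_one (α := ℝ)))] with ϱ h1 hϱ h2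
  have hϱ : 0 < ϱ := hϱ
  refine lt_of_lt_of_le ?_ (gaugeIntegral_crossPolytope_ge k hϱ (by linarith [h2.2]))
  rw [volume_crossPolytope]
  have hc : (0 : ℝ) < 2 ^ (k + 2) / (k + 2).factorial := by positivity
  have hsq : √(k + 2 : ℕ) ^ 2 = (k : ℝ) + 2 := by
    rw [Real.sq_sqrt (Nat.cast_nonneg _)]; push_cast; ring
  have e : (1 - √(k + 2 : ℕ) * ϱ) ^ (k + 2) * (2 ^ (k + 2) / (k + 2).factorial) +
      2 * ((k + 1 : ℕ) + 1) * ((1 - √(k + 2 : ℕ) * ϱ) ^ (k + 1) *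
        (2 ^ (k + 1) / (k + 1).factorial)) * (ϱ / √(k + 2 : ℕ)) +
      (k + 2) * (2 * (k + 1) * ((1 - √(k + 2 : ℕ) * ϱ) ^ k * (2 ^ k / k.factorial)) *
        (gaugeMoment * ϱ ^ 2 * (2 / (k + 1) * (1 - 1 / (3 * (k + 1)))))) =
      (2 ^ (k + 2) / (k + 2).factorial) *
      ((1 - √(k + 2 : ℕ) * ϱ) ^ (k + 2) +
        (k + 2) * (√(k + 2 : ℕ) * ϱ) * (1 - √(k + 2 : ℕ) * ϱ) ^ (k + 1) +
        κ * ((k + 2) * (k + 1)) * (√(k + 2 : ℕ) * ϱ) ^ 2 * (1 - √(k + 2 : ℕ) * ϱ) ^ k) := by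
    have hdiv : ϱ / √(k + 2 : ℕ) = √(k + 2 : ℕ) * ϱ / (k + 2) := by
      rw [← hsq]; field_simp
    have hf1 : ((k + 2).factorial : ℝ) = (k + 2) * ((k + 1) * k.factorial) := by
      rw [Nat.factorial_succ, Nat.factorial_succ]; push_cast; ring
    have hf2 : ((k + 1).factorial : ℝ) = (k + 1) * k.factorial := by
      rw [Nat.factorial_succ]; push_cast; ring
    have hf0 : (k.factorial : ℝ) ≠ 0 := by positivity
    rw [mul_pow (√(k + 2 : ℕ)) ϱ 2, hsq, hdiv, hf1, hf2, hκdef]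
    push_cast
    generalize 1 - 1 / (3 * ((k : ℝ) + 1)) = z
    generalize √((k : ℝ) + 2) * ϱ = x
    field_simp
    ring
  rw [e]
  exact (ENNReal.ofReal_lt_ofReal_iff_of_nonneg hc.le).2 (lt_mul_of_one_lt_right hc h1)

theorem mainTheorem1 (n : ℕ) (hn : 7 ≤ n) :
    packingDensity (crossPolytope n) < 1 ∧
    (∀ ϱ : ℝ, 0 < ϱ → ϱ ≤ 1 / √(n : ℝ) →
      packingDensity (crossPolytope n) ≤
        volume (crossPolytope n) / gaugeIntegral gaugeStar (crossPolytope n) ϱ) ∧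
    (∀ᶠ ϱ in 𝓝[>] (0 : ℝ),
      volume (crossPolytope n) / gaugeIntegral gaugeStar (crossPolytope n) ϱ < 1) := by
  have hn0 : 0 < n := by omega
  have hs : (0 : ℝ) < 1 / √n := by positivity
  have hbound : ∀ ϱ : ℝ, 0 < ϱ → ϱ ≤ 1 / √(n : ℝ) →
      packingDensity (crossPolytope n) ≤
        volume (crossPolytope n) / gaugeIntegral gaugeStar (crossPolytope n) ϱ := by
    intro ϱ hϱ hϱn
    have h0 := zero_mem_innerParallel_crossPolytope hn0 hϱ.le hϱn
    refine packingDensity_le_volume_div_gaugeIntegral (isCompact_crossPolytope n) ?_ hϱ ⟨0, h0⟩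
    exact ⟨0, interior_maximal (Metric.ball_subset_closedBall.trans h0.2) Metric.isOpen_ball
      (Metric.mem_ball_self hϱ)⟩
  have hlt : ∀ᶠ ϱ in 𝓝[>] (0 : ℝ),
      volume (crossPolytope n) / gaugeIntegral gaugeStar (crossPolytope n) ϱ < 1 := by
    filter_upwards [eventually_volume_lt_gaugeIntegral hn] with ϱ h
    rw [ENNReal.div_lt_iff (Or.inl (pos_of_gt h).ne')
      (Or.inr (isCompact_crossPolytope n).measure_lt_top.ne), one_mul]
    exact h
  obtain ⟨ϱ, h1, h2⟩ := (hlt.and (Ioc_mem_nhdsGT hs)).exists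
  exact ⟨(hbound ϱ h2.1 h2.2).trans_lt h1, hbound, hlt⟩
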